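/- Consider sending one bit $D$, equiprobable on $\{0,1\}$, over the continuous-time Poisson channel with dark current $\lambda_0\ge 0$ and noiseless feedback. A scheme with transmission interval $[0,T]$ consists of a probability space carrying $D$ and a simple point process on $(0,\infty)$ with counting process $Y(t)$ (the channel output, almost surely finite for all $t$) and, for each $d\in\{0,1\}$, a history (filtration) $(\mathcal F^d_t)_{t\ge0}$ to which $Y$ is adapted and a nonnegative $\mathcal F^d_t$-progressive input process $X_d$. It is required that, conditionally on $D=d$, almost surely $\int_0^t X_d(s)\,ds<\infty$ for all $t\geq 0$, and that $Y$ admits the $\mathcal F^d_t$-intensity $X_d(t)+\lambda_0$, i.e. $$\mathbb E\Bigl[\int_0^\infty C(t)\,dY(t)\Bigm| D=d\Bigr]=\mathbb E\Bigl[\int_0^\infty C(t)\,(X_d(t)+\lambda_0)\,dt\Bigm| D=d\Bigr]$$ for every nonnegative $\mathcal F^d_t$-predictable process $C$. The decoder produces a guess $\hat D\in\{0,1\}$ that is measurable with respect to $\sigma(Y(t):0\le t\le T)$. The energy of the scheme (its mean number of transmitted photons) is $\tfrac12(\mathcal E_0+\mathcal E_1)$, where $\mathcal E_d=\mathbb E[\int_0^T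 X_d(t)\,dt\mid D=d]$, and its error probability is $\Pr(\hat D\ne D)$. The scheme satisfies the peak-power constraint $\mathsf A$ if, for each $d$, conditionally on $D=d$, almost surely $X_d(t)\le\mathsf A$ for all $t\geq 0$. A bit can be transmitted reliably with energy $\mathcal E$ if for every $\varepsilon>0$ there are a $T$ and a scheme with transmission interval $[0,T]$, energy $\mathcal E$, and error probability smaller than $\varepsilon$. **Theorem.** For every dark current $\lambda_0\ge 0$, in the absence of a peak-power constraint, there is a least energy with which a bit can be transmitted reliably, and it is $$\mathcal E_{\min}=\tfrac12 .$$ If $\lambda_0=0$, then, for every $\mathsf A>0$, a bit can be transmitted reliably with energy $\tfrac12$ by schemes that satisfy the peak-power constraint $\mathsf A$. -/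

import Mathlib

open MeasureTheory ProbabilityTheory
open scoped ENNReal NNReal

universe u

/-- Lebesgue measure `dt` on the time axis `[0, ∞)`. -/
noncomputable def timeMeasure : Measure ℝ≥0 :=
  Measure.comap ((↑) : ℝ≥0 → ℝ) volume

/-- A realization of a simple point process on `(0, ∞)`, given by its successive points
`τ 0, τ 1, …`: they are positive and strictly increasing as long as they are finite, and the value
`∞` at `n` (hence at all later indices) means that there are at most `n` points. -/
structure IsPointSequence (τ : ℕ → ℝ≥0∞) : Prop where
  pos : 0 < τ 0
  mono : Monotone τ
  lt_succ : ∀ n, τ n < ∞ → τ n < τ (n + 1)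

/-- The number `Y(t)` of points in `[0, t]`. -/
noncomputable def count (τ : ℕ → ℝ≥0∞) (t : ℝ≥0) : ℕ∞ :=
  {n : ℕ | τ n ≤ t}.encard

/-- The integral `∫₀^∞ c(t) dY(t)` against the counting path with points `τ`, i.e. the sum of `c`
over the (finite) points. -/
noncomputable def countIntegral (τ : ℕ → ℝ≥0∞) (c : ℝ≥0 → ℝ≥0) : ℝ≥0∞ :=
  ∑' n : ℕ, if τ n = ∞ then 0 else (c (τ n).toNNReal : ℝ≥0∞)

/-- Under the probability measure `P`, the point process with points `τ` admits the
`F`-intensity `ℓ`: its counting process is almost surely finite and adapted to the history `F`, the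
nonnegative process `ℓ` is `F`-progressive and almost surely locally integrable, and
`E[∫₀^∞ C(t) dY(t)] = E[∫₀^∞ C(t) ℓ(t) dt]` for every nonnegative `F`-predictable process `C`. -/
structure AdmitsIntensity {Ω : Type*} {m : MeasurableSpace Ω} (F : Filtration ℝ≥0 m)
    (P : Measure Ω) (τ : ℕ → Ω → ℝ≥0∞) (ℓ : ℝ≥0 → Ω → ℝ≥0) : Prop where
  isPointSequence : ∀ ω, IsPointSequence fun n => τ n ω
  count_lt_top : ∀ᵐ ω ∂P, ∀ t, count (fun n => τ n ω) t < ⊤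
  adapted : Adapted F fun t ω => count (fun n => τ n ω) t
  progressive : IsStronglyProgressive F ℓ
  locallyIntegrable : ∀ᵐ ω ∂P, ∀ t : ℝ≥0, ∫⁻ s in Set.Icc 0 t, (ℓ s ω : ℝ≥0∞) ∂timeMeasure < ∞
  lintegral_eq : ∀ C : ℝ≥0 → Ω → ℝ≥0, IsStronglyPredictable F C →
    ∫⁻ ω, countIntegral (fun n => τ n ω) (fun t => C t ω) ∂P =
      ∫⁻ ω, (∫⁻ t, (C t ω : ℝ≥0∞) * (ℓ t ω : ℝ≥0∞) ∂timeMeasure) ∂P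

/-- A scheme for sending one equiprobable bit over the Poisson channel with dark current `darkCurrent`
and noiseless feedback, using the transmission interval `[0, T]`.
Feedback enters through the histories: the input need only be progressive with respect to a history
to which the output is adapted, so that it may depend causally on the output. -/
structure FeedbackScheme (darkCurrent T : ℝ≥0) {Ω : Type*} [m : MeasurableSpace Ω]
    (P : Measure Ω) where
  /-- The bit `D`. -/
  bit : Ω → Bool
  measurable_bit : Measurable bit
  prob_bit : ∀ d, P (bit ⁻¹' {d}) = 1 / 2
  /-- The points (counts) of the channel output `Y`. -/
  output : ℕ → Ω → ℝ≥0∞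
  /-- The history used when `D = d`. -/
  history : Bool → Filtration ℝ≥0 m
  /-- The input `X_d` used when `D = d`. -/
  input : Bool → ℝ≥0 → Ω → ℝ≥0
  progressive_input : ∀ d, IsStronglyProgressive (history d) (input d)
  /-- Conditionally on `D = d`, the output admits the intensity `X_d(t) + darkCurrent`. -/
  admitsIntensity : ∀ d, AdmitsIntensity (history d) (cond P (bit ⁻¹' {d})) output
    (fun t ω => input d t ω + darkCurrent)
  /-- The decoder's guess of `D`, a function of `Y(t)`, `0 ≤ t ≤ T`. -/
  guess : Ω → Bool
  measurable_guess : Measurable[⨆ t : Set.Icc (0 : ℝ≥0) T,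
    MeasurableSpace.comap (fun ω => count (fun n => output n ω) t) inferInstance] guess

namespace FeedbackScheme

variable {darkCurrent T : ℝ≥0} {Ω : Type*} [MeasurableSpace Ω] {P : Measure Ω}

/-- The conditional expected energy `E[∫₀^T X_d(t) dt | D = d]`. -/
noncomputable def condEnergy (S : FeedbackScheme darkCurrent T P) (d : Bool) : ℝ≥0∞ :=
  ∫⁻ ω, (∫⁻ t in Set.Icc 0 T, (S.input d t ω : ℝ≥0∞) ∂timeMeasure) ∂(cond P (S.bit ⁻¹' {d}))

/-- The average transmitted energy. -/
noncomputable def energy (S : FeedbackScheme darkCurrent T P) : ℝ≥0∞ :=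
  (S.condEnergy false + S.condEnergy true) / 2

/-- The probability of a decoding error. -/
noncomputable def errorProb (S : FeedbackScheme darkCurrent T P) : ℝ≥0∞ :=
  P {ω | S.guess ω ≠ S.bit ω}

/-- The peak-power constraint: almost surely, the input never exceeds `A`. It is void for
`A = ∞`. -/
def PeakPowerLE (S : FeedbackScheme darkCurrent T P) (A : ℝ≥0∞) : Prop :=
  ∀ d, ∀ᵐ ω ∂(cond P (S.bit ⁻¹' {d})), ∀ t, (S.input d t ω : ℝ≥0∞) ≤ A

end FeedbackScheme

/-- One bit can be transmitted reliably with average transmitted energy `E` over the Poisson channel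
with the given dark current, noiseless feedback, and maximal allowed power `A` (no peak-power
constraint if `A = ∞`): for every `ε > 0` there are a transmission interval and a coding/decoding
rule of expected energy `E` and probability of error smaller than `ε`. -/
def ReliablyTransmissible (darkCurrent : ℝ≥0) (A E : ℝ≥0∞) : Prop :=
  ∀ ε : ℝ≥0∞, 0 < ε → ∃ (T : ℝ≥0) (Ω : Type u) (_ : MeasurableSpace Ω) (P : Measure Ω)
    (_ : IsProbabilityMeasure P) (S : FeedbackScheme darkCurrent T P),
    S.PeakPowerLE A ∧ S.energy = E ∧ S.errorProb < ε

/-!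
Let `E₀`, `E₁` be the conditional mean energies of a scheme given `D = 0` and `D = 1`; its energy is
`(E₀ + E₁) / 2`.

**Converse.** Under either hypothesis the output is close to the Poisson process of rate
`darkCurrent`: the probability of an event of `[0, T]` differs from its probability for that process
by at most `E_d`. Hence the two conditional error probabilities and the two energies sum to at least
one, which is `FeedbackScheme.one_half_le`. For the comparison, let `u n r` be the expectation of
`g (Y t)` for the Poisson process started at time `r` in the state `n` (`poissonMean`). It solves
Kolmogorov's backward equation, so the fundamental theorem of calculus along a path of `Y`
(`sub_eq_sum_jumps_sub_integral`) writes `g (Y t) - u (Y s) s` as the integral of the predictable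
process `u (Y(r-) + 1) r - u (Y(r-)) r` against `dY - darkCurrent * dr`. In expectation the
intensity formula replaces `dY` by `(X + darkCurrent) dr`; what is left is the integral of that
process, which has values in `[-1, 1]`, against `X dr`
(`AdmitsIntensity.setLIntegral_poissonMean_le`). The argument needs no description of the input as
a functional of the output, so it covers every history. Iteration over a time grid
(`AdmitsIntensity.poissonValue_le`) and approximation of the decoding event by events of finitely
many times (`one_le_add_of_outputAlgebra`) complete the comparison.

**Achievability.** If `D = d`, transmit at constant power `a d` until the first count, and then
stop; guess `1` if there is a count in `[0, T]`. The output has independent exponential gaps, the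
first of rate `a d + darkCurrent` and the others of rate `darkCurrent`, and its intensity is
computed gap by gap (`IsExponentialGaps.lintegral_gap`): before the `(n+1)`-st point, events of
the history depend only on the first `n` gaps, of which the next one is independent. If the power
`a true` is large and `darkCurrent * T` is small, or if there is no dark current and `T` is large,
then given `D = 1` a count occurs with probability close to one at a mean energy slightly below
one. The remainder `1 - E₁` is spent when `D = 0`, with a power `a false` found by the intermediate
value theorem. As this energy is small, so is the probability of a count in `[0, T]` given `D = 0`
(`reliablyTransmissible_half`).
-/

/-! ### Lebesgue measure on the time axis -/

theorem lintegral_timeMeasure (c : ℝ≥0 → ℝ≥0∞) :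
    ∫⁻ t, c t ∂timeMeasure = ∫⁻ x in Set.Ici (0 : ℝ), c x.toNNReal := by
  have h := lintegral_subtype_comap (μ := (volume : Measure ℝ)) (s := Set.Ici (0 : ℝ))
    measurableSet_Ici (fun x => c x.toNNReal)
  rw [← h]
  refine lintegral_congr fun t => ?_
  exact congrArg c (Real.toNNReal_coe (r := t)).symm

instance : NullSingletonClass timeMeasure where
  measure_singleton t := by
    have h : MeasurableEmbedding ((↑) : ℝ≥0 → ℝ) :=
      MeasurableEmbedding.subtype_coe measurableSet_Ici
    rw [timeMeasure, h.comap_apply, Set.image_singleton]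
    exact measure_singleton _

theorem timeMeasure_Ioc (s t : ℝ≥0) : timeMeasure (Set.Ioc s t) = ENNReal.ofReal (t - s) := by
  have h : MeasurableEmbedding ((↑) : ℝ≥0 → ℝ) :=
    MeasurableEmbedding.subtype_coe measurableSet_Ici
  rw [timeMeasure, h.comap_apply, ← Real.volume_Ioc]
  congr 1
  ext x
  simp only [Set.mem_image, Set.mem_Ioc]
  constructor
  · rintro ⟨y, ⟨h1, h2⟩, rfl⟩
    exact ⟨by exact_mod_cast h1, by exact_mod_cast h2⟩
  · rintro ⟨h1, h2⟩
    have h0 : 0 ≤ x := s.2.trans h1.le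
    exact ⟨⟨x, h0⟩, ⟨by exact_mod_cast h1, by exact_mod_cast h2⟩, rfl⟩

theorem timeMeasure_Iic (t : ℝ≥0) : timeMeasure (Set.Iic t) = t := by
  have h : Set.Iic t = {0} ∪ Set.Ioc 0 t := by
    ext x
    simp only [Set.mem_Iic, Set.singleton_union, Set.mem_insert_iff, Set.mem_Ioc]
    constructor
    · intro hx
      rcases eq_or_lt_of_le (zero_le (a := x)) with h | h
      · exact Or.inl h.symm
      · exact Or.inr ⟨h, hx⟩
    · rintro (rfl | h)
      · exact zero_le
      · exact h.2
  rw [h, measure_union (by simp) measurableSet_Ioc, measure_singleton, timeMeasure_Ioc]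
  simp

instance : SigmaFinite timeMeasure :=
  ⟨⟨{ set := fun n : ℕ => Set.Iic (n : ℝ≥0)
      set_mem := fun _ => trivial
      finite := fun n => by rw [timeMeasure_Iic]; exact ENNReal.coe_lt_top
      spanning := by
        refine Set.eq_univ_of_forall fun x => Set.mem_iUnion.2 ?_
        obtain ⟨n, hn⟩ := exists_nat_ge x
        exact ⟨n, hn⟩ }⟩⟩

/-! ### Exponential gaps -/

/-- The law of the waiting time, with values in `(0, ∞]`, for an event of constant rate `κ`: the
exponential distribution if `κ > 0`, and `∞` with probability one if `κ = 0`. -/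
noncomputable def gapLaw (κ : ℝ≥0) : Measure ℝ≥0∞ :=
  if κ = 0 then Measure.dirac ∞ else (expMeasure κ).map ENNReal.ofReal

instance (κ : ℝ≥0) : IsProbabilityMeasure (gapLaw κ) := by
  unfold gapLaw
  split_ifs with h
  · infer_instance
  · have : IsProbabilityMeasure (expMeasure κ) :=
      isProbabilityMeasure_expMeasure (by exact_mod_cast pos_iff_ne_zero.2 h)
    exact Measure.isProbabilityMeasure_map ENNReal.measurable_ofReal.aemeasurable

theorem lintegral_expMeasure (κ : ℝ≥0) {f : ℝ → ℝ≥0∞} (hf : Measurable f) :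
    ∫⁻ x, f x ∂expMeasure κ
      = ∫⁻ x in Set.Ioi 0, ENNReal.ofReal (κ * Real.exp (-(κ * x))) * f x := by
  have h1 : expMeasure κ = volume.withDensity (exponentialPDF κ) := rfl
  have h2 : Measurable (exponentialPDF κ) := (measurable_exponentialPDFReal κ).ennreal_ofReal
  rw [h1, lintegral_withDensity_eq_lintegral_mul _ h2 hf,
    Measure.restrict_congr_set (Ioi_ae_eq_Ici (a := (0 : ℝ))),
    ← lintegral_indicator measurableSet_Ici]
  refine lintegral_congr fun x => ?_
  simp only [Pi.mul_apply, Set.indicator_apply, Set.mem_Ici]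
  split_ifs with h
  · rw [exponentialPDF_of_nonneg h]
  · rw [exponentialPDF_of_neg (not_le.1 h), zero_mul]

theorem lintegral_gapLaw {κ : ℝ≥0} (hκ : κ ≠ 0) {f : ℝ≥0∞ → ℝ≥0∞} (hf : Measurable f) :
    ∫⁻ g, f g ∂gapLaw κ
      = ∫⁻ x in Set.Ioi 0, ENNReal.ofReal (κ * Real.exp (-(κ * x))) * f (ENNReal.ofReal x) := by
  rw [gapLaw, if_neg hκ, lintegral_map hf ENNReal.measurable_ofReal,
    lintegral_expMeasure κ (f := fun x => f (ENNReal.ofReal x))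
      (hf.comp ENNReal.measurable_ofReal)]

theorem gapLaw_singleton (κ : ℝ≥0) {x : ℝ≥0∞} (hx : x ≠ ∞) : gapLaw κ {x} = 0 := by
  by_cases hκ : κ = 0
  · simp [gapLaw, hκ, hx.symm]
  · rw [← lintegral_indicator_one (measurableSet_singleton _), lintegral_gapLaw hκ
      (measurable_one.indicator (measurableSet_singleton _)),
      ← lintegral_indicator measurableSet_Ioi]
    have hae : ∀ᵐ y : ℝ, y ≠ x.toReal := by simp [ae_iff]
    rw [lintegral_congr_ae (g := fun _ => 0), lintegral_zero]
    filter_upwards [hae] with y hy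
    simp only [Set.indicator_apply, Set.mem_Ioi, Set.mem_singleton_iff, Pi.one_apply]
    split_ifs with h1 h2
    · exact absurd (by rw [← h2, ENNReal.toReal_ofReal h1.le]) hy
    · simp
    · rfl

/-- The tail of the waiting time at a finite level. -/
theorem gapLaw_Ici (κ : ℝ≥0) {x : ℝ} (hx : 0 ≤ x) :
    gapLaw κ (Set.Ici (ENNReal.ofReal x)) = ENNReal.ofReal (Real.exp (-(κ * x))) := by
  by_cases hκ : κ = 0
  · simp [gapLaw, hκ]
  · have hκ' : (0 : ℝ) < κ := by exact_mod_cast pos_iff_ne_zero.2 hκ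
    have : IsProbabilityMeasure (expMeasure κ) := isProbabilityMeasure_expMeasure hκ'
    have hna : NullSingletonClass (expMeasure κ) := by
      have h1 : expMeasure κ = volume.withDensity (exponentialPDF κ) := rfl
      rw [h1]; infer_instance
    have h1 : gapLaw κ (Set.Ici (ENNReal.ofReal x)) = expMeasure κ (Set.Ioi x) := by
      rw [gapLaw, if_neg hκ, Measure.map_apply ENNReal.measurable_ofReal measurableSet_Ici]
      rcases eq_or_lt_of_le hx with rfl | hx'
      · have h2 : expMeasure κ (Set.Iic 0) = 0 := by
          rw [← ENNReal.toReal_eq_zero_iff _ |>.trans (or_iff_left (measure_ne_top _ _))]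
          have := cdf_expMeasure_eq hκ' 0
          rw [cdf_eq_real] at this
          simpa [Measure.real] using this
        have h3 : expMeasure κ (Set.Ioi 0) = 1 := by
          rw [← Set.compl_Iic, prob_compl_eq_one_sub measurableSet_Iic, h2, tsub_zero]
        simp [h3]
      · rw [measure_congr (Ioi_ae_eq_Ici (μ := expMeasure κ) (a := x))]
        congr 1
        ext y
        simp only [Set.mem_preimage, Set.mem_Ici]
        rw [ENNReal.ofReal_le_ofReal_iff']
        exact ⟨fun h => h.resolve_right hx'.not_ge, Or.inl⟩
    rw [h1, ← Set.compl_Iic, prob_compl_eq_one_sub measurableSet_Iic]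
    have h2 := cdf_expMeasure_eq hκ' x
    rw [cdf_eq_real, if_pos hx, Measure.real] at h2
    rw [← ENNReal.ofReal_toReal (measure_ne_top (expMeasure κ) (Set.Iic x)), h2,
      ← ENNReal.ofReal_one, ← ENNReal.ofReal_sub _ (by
        rw [sub_nonneg]; exact Real.exp_le_one_iff.2 (by simp; positivity))]
    congr 1; ring

theorem gapLaw_Iic (κ : ℝ≥0) (T : ℝ≥0) :
    gapLaw κ (Set.Iic (T : ℝ≥0∞)) = ENNReal.ofReal (1 - Real.exp (-(κ * T))) := by
  have h1 : gapLaw κ (Set.Ioi (T : ℝ≥0∞)) = ENNReal.ofReal (Real.exp (-(κ * T))) := by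
    rw [← gapLaw_Ici κ T.coe_nonneg, ENNReal.ofReal_coe_nnreal]
    refine le_antisymm (measure_mono Set.Ioi_subset_Ici_self) ?_
    rw [← Set.Ioi_union_left]
    refine (measure_union_le _ _).trans ?_
    rw [gapLaw_singleton κ ENNReal.coe_ne_top, add_zero]
  rw [← Set.compl_Ioi, prob_compl_eq_one_sub measurableSet_Ioi, h1, ← ENNReal.ofReal_one,
    ENNReal.ofReal_sub _ (Real.exp_nonneg _)]

/-- The waiting time after the instant `p` has constant hazard rate `κ`: the expectation of a
function of the instant at which the event occurs is `κ` times the expectation of its integral over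
the time spent waiting. -/
theorem lintegral_gapLaw_hazard (κ : ℝ≥0) (p : ℝ≥0∞) {c : ℝ≥0 → ℝ≥0∞} (hc : Measurable c) :
    ∫⁻ g, (if p + g = ∞ then 0 else c (p + g).toNNReal) ∂gapLaw κ
      = κ * ∫⁻ g, ∫⁻ t, (if p < t ∧ (t : ℝ≥0∞) ≤ p + g then c t else 0) ∂timeMeasure
          ∂gapLaw κ := by
  by_cases hκ : κ = 0
  · have h1 : gapLaw κ = Measure.dirac ∞ := if_pos hκ
    rw [h1, lintegral_dirac]
    simp [hκ]
  induction p with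
  | top => simp
  | coe p =>
  have hL : Measurable fun g : ℝ≥0∞ => if (p : ℝ≥0∞) + g = ∞ then 0 else c (p + g).toNNReal := by
    refine Measurable.ite ?_ measurable_const ?_
    · exact measurableSet_eq_fun (by fun_prop) measurable_const
    · exact hc.comp (ENNReal.measurable_toNNReal.comp (by fun_prop))
  rw [lintegral_gapLaw hκ hL, lintegral_lintegral_swap]
  · -- by Tonelli, the time spent waiting is weighted by the tail of the law
    have h1 : ∀ t : ℝ≥0, ∫⁻ g, (if (p : ℝ≥0∞) < t ∧ (t : ℝ≥0∞) ≤ p + g then c t else 0) ∂gapLaw κ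
        = if p < t then ENNReal.ofReal (Real.exp (-(κ * (t - p : ℝ)))) * c t else 0 := by
      intro t
      split_ifs with hpt
      · have h2 : (fun g : ℝ≥0∞ => if (p : ℝ≥0∞) < t ∧ (t : ℝ≥0∞) ≤ p + g then c t else 0)
            = (Set.Ici (ENNReal.ofReal (t - p : ℝ))).indicator (fun _ => c t) := by
          ext g
          have h3 : (ENNReal.ofReal (t - p : ℝ)) = (t : ℝ≥0∞) - p := by
            rw [ENNReal.ofReal_sub _ p.coe_nonneg]; simp
          simp [Set.indicator_apply, hpt, h3, add_comm]
        rw [h2, lintegral_indicator_const measurableSet_Ici, gapLaw_Ici κ, mul_comm]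
        exact sub_nonneg.2 (by exact_mod_cast hpt.le)
      · simp [hpt]
    simp_rw [h1]
    rw [lintegral_timeMeasure, ← lintegral_const_mul' _ _ ENNReal.coe_ne_top,
      ← lintegral_indicator measurableSet_Ici, ← lintegral_indicator measurableSet_Ioi,
      ← lintegral_add_right_eq_self (μ := volume) ((Set.Ici (0 : ℝ)).indicator _) (p : ℝ)]
    refine lintegral_congr fun x => ?_
    simp only [Set.indicator_apply, Set.mem_Ioi, Set.mem_Ici]
    have e1 : (0 ≤ x + p ∧ p < (x + p).toNNReal) ↔ 0 < x := by
      rw [Real.lt_toNNReal_iff_coe_lt]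
      constructor
      · intro h; linarith [h.2]
      · intro h; exact ⟨by positivity, by linarith⟩
    by_cases hx : 0 < x
    · have h3 := e1.2 hx
      rw [if_pos hx, if_pos h3.1, if_pos h3.2]
      have h4 : (p : ℝ≥0∞) + ENNReal.ofReal x = ENNReal.ofReal (x + p) := by
        rw [ENNReal.ofReal_add hx.le p.coe_nonneg, add_comm]; simp
      have h5 : (ENNReal.ofReal (x + p)).toNNReal = (x + p).toNNReal := ENNReal.toNNReal_coe _
      rw [h4, if_neg ENNReal.ofReal_ne_top, h5, Real.coe_toNNReal _ h3.1,
        ENNReal.ofReal_mul κ.coe_nonneg, mul_assoc]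
      simp
    · rw [if_neg hx]
      by_cases h5 : 0 ≤ x + p
      · rw [if_pos h5, if_neg fun h6 => hx (e1.1 ⟨h5, h6⟩), mul_zero]
      · rw [if_neg h5]
  · refine Measurable.aemeasurable ?_
    refine Measurable.ite ?_ (hc.comp measurable_snd) measurable_const
    exact (measurableSet_lt measurable_const (f := fun _ : ℝ≥0∞ × ℝ≥0 => (p : ℝ≥0∞))
      (g := fun z => (z.2 : ℝ≥0∞)) (by fun_prop)).inter
      (measurableSet_le (f := fun z : ℝ≥0∞ × ℝ≥0 => (z.2 : ℝ≥0∞))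
        (g := fun z => p + z.1) (by fun_prop) (by fun_prop))

/-! ### Counting paths and the history of the output -/

theorem lt_encard_iff_mem {S : Set ℕ} (hS : IsLowerSet S) (k : ℕ) :
    (k : ℕ∞) < S.encard ↔ k ∈ S := by
  constructor
  · intro h
    by_contra hk
    have h1 : S ⊆ (Finset.range k : Set ℕ) := by
      intro n hn
      by_contra hnk
      exact hk (hS (by simpa using hnk) hn)
    have h2 := Set.encard_le_encard h1
    rw [Set.encard_coe_eq_coe_finsetCard, Finset.card_range] at h2
    exact absurd h (not_lt.2 h2)
  · intro h
    have h1 : (Finset.range (k + 1) : Set ℕ) ⊆ S := by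
      intro n hn
      have : n ≤ k := by simpa [Nat.lt_succ_iff] using hn
      exact hS this h
    have h2 := Set.encard_le_encard h1
    rw [Set.encard_coe_eq_coe_finsetCard, Finset.card_range] at h2
    refine lt_of_lt_of_le ?_ h2
    exact_mod_cast Nat.lt_succ_self k

theorem lt_count_iff {τ : ℕ → ℝ≥0∞} (hτ : Monotone τ) (k : ℕ) (t : ℝ≥0) :
    (k : ℕ∞) < count τ t ↔ τ k ≤ t :=
  lt_encard_iff_mem (S := {n | τ n ≤ t}) (fun _ _ hab ha => (hτ hab).trans ha) k

theorem count_eq_sum_range {τ : ℕ → ℝ≥0∞} (hτ : Monotone τ) {n : ℕ} {t : ℝ≥0} (h : t < τ n) :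
    count τ t = ∑ k ∈ Finset.range n, if τ k ≤ t then (1 : ℕ∞) else 0 := by
  have h1 : {k : ℕ | τ k ≤ t} = ((Finset.range n).filter fun k => τ k ≤ t : Finset ℕ) := by
    ext k
    simp only [Set.mem_ofPred_eq, Finset.coe_filter, Finset.mem_range]
    refine ⟨fun hk => ⟨?_, hk⟩, fun hk => hk.2⟩
    by_contra hnk
    exact absurd (h.trans_le (hτ (not_lt.1 hnk))) (not_lt.2 hk)
  rw [count, h1, Set.encard_coe_eq_coe_finsetCard, Finset.card_filter]
  push_cast
  rfl

theorem measurable_encard_of_isLowerSet {Ω : Type*} {m : MeasurableSpace Ω} {S : Ω → Set ℕ}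
    (hS : ∀ ω, IsLowerSet (S ω)) (hm : ∀ k, MeasurableSet {ω | k ∈ S ω}) :
    Measurable fun ω => (S ω).encard := by
  have hlt : ∀ k : ℕ, MeasurableSet {ω | (k : ℕ∞) < (S ω).encard} := by
    intro k
    simp_rw [lt_encard_iff_mem (hS _)]
    exact hm k
  refine measurable_to_countable' fun x => ?_
  induction x with
  | top =>
    have : (fun ω => (S ω).encard) ⁻¹' {⊤} = ⋂ k : ℕ, {ω | (k : ℕ∞) < (S ω).encard} := by
      ext ω
      simp only [Set.mem_preimage, Set.mem_singleton_iff, Set.mem_iInter, Set.mem_ofPred_eq]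
      exact ENat.eq_top_iff_forall_gt
    rw [this]
    exact MeasurableSet.iInter hlt
  | coe n =>
    cases n with
    | zero =>
      have : (fun ω => (S ω).encard) ⁻¹' {((0 : ℕ) : ℕ∞)}
          = {ω | ((0 : ℕ) : ℕ∞) < (S ω).encard}ᶜ := by
        ext ω
        simp [Set.not_nonempty_iff_eq_empty]
      rw [this]
      exact (hlt 0).compl
    | succ n =>
      have : (fun ω => (S ω).encard) ⁻¹' {((n + 1 : ℕ) : ℕ∞)}
          = {ω | (n : ℕ∞) < (S ω).encard} \ {ω | ((n + 1 : ℕ) : ℕ∞) < (S ω).encard} := by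
        ext ω
        simp only [Set.mem_preimage, Set.mem_singleton_iff, Set.mem_sdiff, Set.mem_ofPred_eq,
          not_lt]
        constructor
        · intro h
          rw [h]
          exact ⟨by exact_mod_cast Nat.lt_succ_self n, le_rfl⟩
        · rintro ⟨h1, h2⟩
          refine le_antisymm h2 ?_
          have := Order.add_one_le_of_lt h1
          exact_mod_cast this
      rw [this]
      exact (hlt n).diff (hlt (n + 1))

theorem measurable_count {Ω : Type*} {m : MeasurableSpace Ω} {τ : ℕ → Ω → ℝ≥0∞}
    (hmono : ∀ ω, Monotone fun n => τ n ω) {t : ℝ≥0}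
    (hτ : ∀ k, MeasurableSet {ω | τ k ω ≤ t}) :
    Measurable fun ω => count (fun n => τ n ω) t :=
  measurable_encard_of_isLowerSet (S := fun ω => {n | τ n ω ≤ t})
    (fun ω _ _ hab ha => (hmono ω hab).trans ha) hτ

/-- The history generated by the counting process with points `τ`. -/
noncomputable def outputHistory {Ω : Type*} {m : MeasurableSpace Ω} (τ : ℕ → Ω → ℝ≥0∞)
    (hmono : ∀ ω, Monotone fun n => τ n ω) (hτ : ∀ n, Measurable (τ n)) : Filtration ℝ≥0 m where
  seq t := ⨆ s : Set.Iic t,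
    MeasurableSpace.comap (fun ω => count (fun n => τ n ω) s) inferInstance
  mono' _ t hst := iSup_le fun r => le_iSup
    (fun r : Set.Iic t => MeasurableSpace.comap (fun ω => count (fun n => τ n ω) r) inferInstance)
    ⟨r.1, le_trans r.2 hst⟩
  le' _ := iSup_le fun _ => (measurable_count hmono fun k =>
    measurableSet_le (hτ k) measurable_const).comap_le

section RenewalPaths

variable {Ω : Type*} {m : MeasurableSpace Ω}

/-- The end of the `n`-th gap: `epoch G n` is the sum of the first `n` gaps. -/
noncomputable def epoch (G : ℕ → Ω → ℝ≥0∞) (n : ℕ) (ω : Ω) : ℝ≥0∞ :=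
  ∑ i ∈ Finset.range n, G i ω

theorem epoch_succ (G : ℕ → Ω → ℝ≥0∞) (n : ℕ) (ω : Ω) :
    epoch G (n + 1) ω = epoch G n ω + G n ω := Finset.sum_range_succ _ _

theorem measurable_epoch {G : ℕ → Ω → ℝ≥0∞} (hG : ∀ n, Measurable (G n)) (n : ℕ) :
    Measurable (epoch G n) := Finset.measurable_fun_sum _ fun i _ => hG i

theorem monotone_epoch (G : ℕ → Ω → ℝ≥0∞) (ω : Ω) : Monotone fun n => epoch G n ω :=
  monotone_nat_of_le_succ fun n => by rw [epoch_succ]; exact le_self_add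

theorem isPointSequence_epoch {G : ℕ → Ω → ℝ≥0∞} (hpos : ∀ n ω, 0 < G n ω) (ω : Ω) :
    IsPointSequence fun n => epoch G (n + 1) ω where
  pos := by simpa [epoch] using hpos 0 ω
  mono := fun a b hab => monotone_epoch G ω (by omega)
  lt_succ n hn := by
    rw [epoch_succ G (n + 1)]
    exact ENNReal.lt_add_right hn.ne (hpos _ _).ne'

/-- The history of the point process with gaps `G`. -/
noncomputable def gapHistory (G : ℕ → Ω → ℝ≥0∞) (hG : ∀ n, Measurable (G n)) : Filtration ℝ≥0 m :=
  outputHistory (fun n => epoch G (n + 1)) (fun ω _ _ hab => monotone_epoch G ω (by omega))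
    fun n => measurable_epoch hG (n + 1)

theorem measurable_count_gapHistory {G : ℕ → Ω → ℝ≥0∞} (hG : ∀ n, Measurable (G n)) {s t : ℝ≥0}
    (hst : s ≤ t) : Measurable[gapHistory G hG t] fun ω => count (fun n => epoch G (n + 1) ω) s :=
  Measurable.mono (Measurable.of_comap_le le_rfl) (le_iSup (fun r : Set.Iic t =>
    MeasurableSpace.comap (fun ω => count (fun n => epoch G (n + 1) ω) r) inferInstance) ⟨s, hst⟩)
    le_rfl

theorem measurableSet_epoch_le_gapHistory {G : ℕ → Ω → ℝ≥0∞} (hG : ∀ n, Measurable (G n))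
    {s t : ℝ≥0} (hst : s ≤ t) (k : ℕ) :
    MeasurableSet[gapHistory G hG t] {ω | epoch G (k + 1) ω ≤ s} := by
  have h := measurable_count_gapHistory hG hst (MeasurableSet.of_discrete (s := Set.Ioi (k : ℕ∞)))
  convert! h using 1
  ext ω
  exact (lt_count_iff (τ := fun n => epoch G (n + 1) ω)
    (fun a b hab => monotone_epoch G ω (by omega)) k s).symm

/-- Until the `(n+1)`-st point has occurred, an event of the history is a function of the first
`n` gaps. -/
theorem exists_past_of_gapHistory {G : ℕ → Ω → ℝ≥0∞} (hG : ∀ n, Measurable (G n)) (n : ℕ)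
    {t : ℝ≥0} {A : Set Ω} (hA : MeasurableSet[gapHistory G hG t] A) :
    ∃ S : Set (Finset.range n → ℝ≥0∞), MeasurableSet S ∧
      ∀ ω, t < epoch G (n + 1) ω → (ω ∈ A ↔ (fun i : Finset.range n => G i ω) ∈ S) := by
  let D : Set Ω := {ω | (t : ℝ≥0∞) < epoch G (n + 1) ω}
  let Z : D → Finset.range n → ℝ≥0∞ := fun ω i => G i ω
  have key : gapHistory G hG t
      ≤ (MeasurableSpace.comap Z inferInstance).map (Subtype.val : D → Ω) := by
    refine iSup_le fun s => ?_
    rw [← MeasurableSpace.comap_le_iff_le_map, MeasurableSpace.comap_comp]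
    refine Measurable.comap_le ?_
    -- on `D`, the count at time `s` is a function of the first `n` gaps
    let ψ : (Finset.range n → ℝ≥0∞) → ℕ∞ := fun z => ∑ k : Fin n,
      if (∑ i : Fin (k + 1), z ⟨i, Finset.mem_range.2 (by omega)⟩) ≤ (s : ℝ≥0) then 1 else 0
    have hψ : Measurable ψ := by
      refine Finset.measurable_fun_sum _ fun k _ => Measurable.ite ?_ measurable_const
        measurable_const
      exact measurableSet_le (Finset.measurable_fun_sum _ fun i _ => measurable_pi_apply _)
        measurable_const
    have : (fun ω => count (fun n => epoch G (n + 1) ω) s) ∘ (Subtype.val : D → Ω) = ψ ∘ Z := by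
      ext1 ω
      have hlt : ((s : ℝ≥0) : ℝ≥0∞) < epoch G (n + 1) ω.1 :=
        lt_of_le_of_lt (by exact_mod_cast s.2) ω.2
      simp only [Function.comp_apply]
      rw [count_eq_sum_range (τ := fun n => epoch G (n + 1) ω.1)
        (fun a b hab => monotone_epoch G ω.1 (by omega)) hlt, Finset.sum_range]
      refine Finset.sum_congr rfl fun k _ => ?_
      simp only [epoch, Finset.sum_range, Z]
    rw [this]
    exact hψ.comp (Measurable.of_comap_le le_rfl)
  obtain ⟨S, hS, hSA⟩ := key A hA
  refine ⟨S, hS, fun ω hω => ?_⟩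
  have := Set.ext_iff.1 hSA ⟨ω, hω⟩
  exact this.symm

end RenewalPaths

/-! ### The intensity of a renewal process with exponential gaps -/

section RenewalIntensity

variable {Ω : Type*} {m : MeasurableSpace Ω}

/-- The process with gaps `G` under the probability measure `Q`: the gaps are positive and
independent, and the `n`-th one is exponential of rate `κ n` (almost surely infinite if
`κ n = 0`). -/
structure IsExponentialGaps (G : ℕ → Ω → ℝ≥0∞) (κ : ℕ → ℝ≥0) (Q : Measure Ω) : Prop where
  measurable : ∀ n, Measurable (G n)
  pos : ∀ n ω, 0 < G n ω
  indep : iIndepFun G Q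
  law : ∀ n, Q.map (G n) = gapLaw (κ n)

variable {G : ℕ → Ω → ℝ≥0∞} {κ : ℕ → ℝ≥0} {Q : Measure Ω} [IsProbabilityMeasure Q]

/-- The hazard identity for the `n`-th gap, for an integrand that depends on the past only through
the previous gaps: by independence, the previous gaps may be regarded as constants. -/
theorem IsExponentialGaps.lintegral_past (h : IsExponentialGaps G κ Q) (n : ℕ)
    {c : (Finset.range n → ℝ≥0∞) → ℝ≥0 → ℝ≥0∞} (hc : Measurable (Function.uncurry c)) :
    ∫⁻ ω, (if epoch G (n + 1) ω = ∞ then 0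
        else c (fun i => G i ω) (epoch G (n + 1) ω).toNNReal) ∂Q
      = κ n * ∫⁻ ω, ∫⁻ t, (if epoch G n ω < t ∧ (t : ℝ≥0∞) ≤ epoch G (n + 1) ω
          then c (fun i => G i ω) t else 0) ∂timeMeasure ∂Q := by
  let Z : Ω → Finset.range n → ℝ≥0∞ := fun ω i => G i ω
  let p : (Finset.range n → ℝ≥0∞) → ℝ≥0∞ := fun z => ∑ i, z i
  have hp : Measurable p := Finset.measurable_fun_sum _ fun i _ => measurable_pi_apply _
  have hpZ : ∀ ω, p (Z ω) = epoch G n ω := fun ω => by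
    simp only [p, Z, epoch]
    exact Finset.sum_coe_sort (Finset.range n) (fun i => G i ω)
  have hZ : Measurable Z := measurable_pi_lambda _ fun i => h.measurable i
  have hind : IndepFun Z (G n) Q := by
    have h1 := h.indep.indepFun_finset (Finset.range n) {n} (by simp) h.measurable
    exact h1.comp measurable_id (measurable_pi_apply (⟨n, by simp⟩ : ({n} : Finset ℕ)))
  have hmap : Q.map (fun ω => (Z ω, G n ω)) = (Q.map Z).prod (gapLaw (κ n)) := by
    rw [← h.law n]
    exact (indepFun_iff_map_prod_eq_prod_map_map hZ.aemeasurable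
      (h.measurable n).aemeasurable).1 hind
  have : IsProbabilityMeasure (Q.map Z) := Measure.isProbabilityMeasure_map hZ.aemeasurable
  have hadd : Measurable fun x : (Finset.range n → ℝ≥0∞) × ℝ≥0∞ => p x.1 + x.2 :=
    (hp.comp measurable_fst).add measurable_snd
  let Ψ : (Finset.range n → ℝ≥0∞) × ℝ≥0∞ → ℝ≥0∞ := fun x =>
    if p x.1 + x.2 = ∞ then 0 else c x.1 (p x.1 + x.2).toNNReal
  have hΨ : Measurable Ψ :=
    Measurable.ite (measurableSet_eq_fun hadd measurable_const) measurable_const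
      (hc.comp (measurable_fst.prodMk (ENNReal.measurable_toNNReal.comp hadd)))
  let φ : ((Finset.range n → ℝ≥0∞) × ℝ≥0∞) × ℝ≥0 → ℝ≥0∞ := fun y =>
    if p y.1.1 < y.2 ∧ (y.2 : ℝ≥0∞) ≤ p y.1.1 + y.1.2 then c y.1.1 y.2 else 0
  have hφ : Measurable φ := by
    refine Measurable.ite ?_
      (hc.comp ((measurable_fst.comp measurable_fst).prodMk measurable_snd)) measurable_const
    have h2 : Measurable fun y : ((Finset.range n → ℝ≥0∞) × ℝ≥0∞) × ℝ≥0 => (y.2 : ℝ≥0∞) :=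
      measurable_coe_nnreal_ennreal.comp measurable_snd
    exact (measurableSet_lt (hp.comp (measurable_fst.comp measurable_fst)) h2).inter
      (measurableSet_le h2 (hadd.comp measurable_fst))
  have hΦ : Measurable fun x => ∫⁻ t, φ (x, t) ∂timeMeasure := hφ.lintegral_prod_right'
  have hZG : Measurable fun ω => (Z ω, G n ω) := hZ.prodMk (h.measurable n)
  have e1 : ∀ ω, p (Z ω) + G n ω = epoch G (n + 1) ω := fun ω => by rw [hpZ, epoch_succ]
  calc _ = ∫⁻ ω, Ψ (Z ω, G n ω) ∂Q := lintegral_congr fun ω => by simp only [Ψ, e1]; rfl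
    _ = ∫⁻ z, ∫⁻ g, Ψ (z, g) ∂gapLaw (κ n) ∂Q.map Z := by
        rw [← lintegral_map hΨ hZG, hmap, lintegral_prod _ hΨ.aemeasurable]
    _ = ∫⁻ z, κ n * ∫⁻ g, ∫⁻ t, φ ((z, g), t) ∂timeMeasure ∂gapLaw (κ n) ∂Q.map Z :=
        lintegral_congr fun z =>
          lintegral_gapLaw_hazard (κ n) (p z) (c := c z) (hc.comp measurable_prodMk_left)
    _ = κ n * ∫⁻ ω, ∫⁻ t, φ ((Z ω, G n ω), t) ∂timeMeasure ∂Q := by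
        rw [lintegral_const_mul' _ _ ENNReal.coe_ne_top, ← lintegral_map hΦ hZG, hmap,
          lintegral_prod _ hΦ.aemeasurable]
    _ = _ := by
        congr 1
        refine lintegral_congr fun ω => lintegral_congr fun t => ?_
        simp only [φ, hpZ, epoch_succ]
        rfl

theorem predictable_le_prod (F : Filtration ℝ≥0 m) :
    F.predictable ≤ (inferInstance : MeasurableSpace (ℝ≥0 × Ω)) :=
  measurableSpace_le_predictable_of_measurableSet
    (fun _ hA => (measurableSet_singleton _).prod (F.le _ _ hA))
    (fun i _ hA => measurableSet_Ioi.prod (F.le i _ hA))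

/-- A finite measure on `[0, ∞) × Ω` that does not charge time `0` is determined on the
predictable sets by the rectangles `(s, ∞) × A` with `A` in the history at time `s`. -/
theorem trim_predictable_eq {F : Filtration ℝ≥0 m} {M N : Measure (ℝ≥0 × Ω)} [IsFiniteMeasure M]
    (hM : M ({0} ×ˢ Set.univ) = 0) (hN : N ({0} ×ˢ Set.univ) = 0)
    (h : ∀ (s : ℝ≥0) (A : Set Ω), MeasurableSet[F s] A →
      M (Set.Ioi s ×ˢ A) = N (Set.Ioi s ×ˢ A)) :
    M.trim (predictable_le_prod F) = N.trim (predictable_le_prod F) := by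
  have hfin : IsFiniteMeasure (M.trim (predictable_le_prod F)) := isFiniteMeasure_trim _
  refine ext_of_generate_finite (m0 := F.predictable) _ rfl ?_ ?_ ?_
  · rintro _ (⟨A, hA, rfl⟩ | ⟨i, A, hA, rfl⟩) _ (⟨B, hB, rfl⟩ | ⟨j, B, hB, rfl⟩) hne
    · refine Or.inl ⟨A ∩ B, hA.inter hB, ?_⟩
      rw [Set.prod_inter_prod, Set.inter_self]
    · exfalso
      obtain ⟨x, hx, hx'⟩ := hne
      have h1 : x.1 = ⊥ := hx.1
      have h2 : j < x.1 := hx'.1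
      rw [h1] at h2
      exact not_lt_bot h2
    · exfalso
      obtain ⟨x, hx, hx'⟩ := hne
      have h1 : x.1 = ⊥ := hx'.1
      have h2 : i < x.1 := hx.1
      rw [h1] at h2
      exact not_lt_bot h2
    · refine Or.inr ⟨max i j, A ∩ B, ?_, ?_⟩
      · exact (F.mono (le_max_left _ _) _ hA).inter (F.mono (le_max_right _ _) _ hB)
      · rw [Set.prod_inter_prod, Set.Ioi_inter_Ioi]
  · intro S hS
    have hS' : MeasurableSet[F.predictable] S := MeasurableSpace.measurableSet_generateFrom hS
    rw [trim_measurableSet_eq _ hS', trim_measurableSet_eq _ hS']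
    rcases hS with ⟨A, hA, rfl⟩ | ⟨i, A, hA, rfl⟩
    · have hsub : ({⊥} : Set ℝ≥0) ×ˢ A ⊆ {0} ×ˢ Set.univ :=
        Set.prod_mono (by simp) (Set.subset_univ _)
      rw [measure_mono_null hsub hM, measure_mono_null hsub hN]
    · exact h i A hA
  · rw [trim_measurableSet_eq _ MeasurableSet.univ, trim_measurableSet_eq _ MeasurableSet.univ]
    have e : (Set.univ : Set (ℝ≥0 × Ω)) = {0} ×ˢ Set.univ ∪ Set.Ioi 0 ×ˢ Set.univ := by
      ext x
      simp [pos_iff_ne_zero, em]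
    have e' : ∀ R : Measure (ℝ≥0 × Ω), R ({0} ×ˢ Set.univ) = 0 →
        R Set.univ = R (Set.Ioi 0 ×ˢ Set.univ) := by
      intro R hR
      rw [e]
      refine le_antisymm ((measure_union_le _ _).trans ?_) (measure_mono Set.subset_union_right)
      rw [hR, zero_add]
    rw [e' M hM, e' N hN]
    exact h 0 _ MeasurableSet.univ

/-- The intensity identity restricted to the `n`-th gap. -/
theorem IsExponentialGaps.lintegral_gap (h : IsExponentialGaps G κ Q) (n : ℕ)
    {C : ℝ≥0 × Ω → ℝ≥0∞} (hC : Measurable[(gapHistory G h.measurable).predictable] C) :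
    ∫⁻ ω, (if epoch G (n + 1) ω = ∞ then 0 else C ((epoch G (n + 1) ω).toNNReal, ω)) ∂Q
      = κ n * ∫⁻ ω, ∫⁻ t, (if epoch G n ω < t ∧ (t : ℝ≥0∞) ≤ epoch G (n + 1) ω
          then C (t, ω) else 0) ∂timeMeasure ∂Q := by
  have hle := predictable_le_prod (gapHistory G h.measurable)
  have hE := fun k => measurable_epoch h.measurable k
  have hfinset : MeasurableSet {ω | epoch G (n + 1) ω = ∞} :=
    measurableSet_eq_fun (hE _) measurable_const
  have hf : Measurable fun ω => ((epoch G (n + 1) ω).toNNReal, ω) :=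
    (ENNReal.measurable_toNNReal.comp (hE _)).prodMk measurable_id
  let I : Set (ℝ≥0 × Ω) := {z | epoch G n z.2 < z.1 ∧ (z.1 : ℝ≥0∞) ≤ epoch G (n + 1) z.2}
  have hI : MeasurableSet I := by
    have h2 : Measurable fun y : ℝ≥0 × Ω => (y.1 : ℝ≥0∞) :=
      measurable_coe_nnreal_ennreal.comp measurable_fst
    exact (measurableSet_lt ((hE n).comp measurable_snd) h2).inter
      (measurableSet_le h2 ((hE (n + 1)).comp measurable_snd))
  let M : Measure (ℝ≥0 × Ω) := (Q.restrict {ω | epoch G (n + 1) ω = ∞}ᶜ).map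
    fun ω => ((epoch G (n + 1) ω).toNNReal, ω)
  let N : Measure (ℝ≥0 × Ω) := (κ n : ℝ≥0∞) • (timeMeasure.prod Q).restrict I
  have hMint : ∀ B : ℝ≥0 × Ω → ℝ≥0∞, Measurable B → ∫⁻ z, B z ∂M = ∫⁻ ω,
      (if epoch G (n + 1) ω = ∞ then 0 else B ((epoch G (n + 1) ω).toNNReal, ω)) ∂Q := by
    intro B hB
    rw [lintegral_map hB hf, ← lintegral_indicator hfinset.compl]
    refine lintegral_congr fun ω => ?_
    by_cases hω : epoch G (n + 1) ω = ∞ <;> simp [hω]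
  have hNint : ∀ B : ℝ≥0 × Ω → ℝ≥0∞, Measurable B → ∫⁻ z, B z ∂N = κ n * ∫⁻ ω, ∫⁻ t,
      (if epoch G n ω < t ∧ (t : ℝ≥0∞) ≤ epoch G (n + 1) ω then B (t, ω) else 0)
        ∂timeMeasure ∂Q := by
    intro B hB
    rw [lintegral_smul_measure, ← lintegral_indicator hI,
      lintegral_prod_symm _ (hB.indicator hI).aemeasurable, smul_eq_mul]
    congr 1
    refine lintegral_congr fun ω => lintegral_congr fun t => ?_
    rw [Set.indicator_apply]
    rfl
  have hMN : M.trim hle = N.trim hle := by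
    have : IsFiniteMeasure M := Measure.isFiniteMeasure_map _ _
    refine trim_predictable_eq ?_ ?_ fun s A hA => ?_
    · rw [Measure.map_apply hf ((measurableSet_singleton _).prod MeasurableSet.univ),
        Measure.restrict_apply' hfinset.compl]
      convert! measure_empty (μ := Q)
      refine Set.eq_empty_of_forall_notMem fun ω hω => ?_
      have h1 : (epoch G (n + 1) ω).toNNReal = 0 := hω.1.1
      have h2 : epoch G (n + 1) ω ≠ ∞ := hω.2
      have h3 : 0 < epoch G (n + 1) ω := by
        rw [epoch_succ]
        exact (h.pos n ω).trans_le le_add_self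
      exact (ENNReal.toNNReal_pos h3.ne' h2).ne' h1
    · rw [Measure.smul_apply, smul_eq_mul]
      have h1 : (timeMeasure.prod Q) ({0} ×ˢ Set.univ) = 0 := by
        rw [Measure.prod_prod, measure_singleton, zero_mul]
      rw [Measure.absolutelyContinuous_of_le Measure.restrict_le_self h1, mul_zero]
    -- during the `n`-th gap, `A` is an event of the past gaps
    · have hA' : MeasurableSet A := (gapHistory G h.measurable).le s A hA
      have hR : MeasurableSet (Set.Ioi s ×ˢ A) := measurableSet_Ioi.prod hA'
      obtain ⟨S, hS, hSA⟩ := exists_past_of_gapHistory h.measurable n hA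
      have key := h.lintegral_past n
        (c := fun z t => (Set.Ioi s ×ˢ S).indicator (fun _ => 1) (t, z))
        ((measurable_const.indicator (measurableSet_Ioi.prod hS)).comp measurable_swap)
      rw [← lintegral_indicator_one hR, ← lintegral_indicator_one hR,
        hMint _ (measurable_one.indicator hR), hNint _ (measurable_one.indicator hR)]
      have hsw : ∀ ω (t : ℝ≥0), (t : ℝ≥0∞) ≤ epoch G (n + 1) ω →
          (Set.Ioi s ×ˢ A).indicator (1 : ℝ≥0 × Ω → ℝ≥0∞) (t, ω)
            = (Set.Ioi s ×ˢ S).indicator (fun _ => 1) (t, fun i : Finset.range n => G i ω) := by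
        intro ω t ht
        have hiff : (t, ω) ∈ Set.Ioi s ×ˢ A
            ↔ (t, fun i : Finset.range n => G i ω) ∈ Set.Ioi s ×ˢ S :=
          and_congr_right fun hst =>
            hSA ω (lt_of_lt_of_le (ENNReal.coe_lt_coe.2 (show s < t from hst)) ht)
        by_cases hx : (t, ω) ∈ Set.Ioi s ×ˢ A
        · rw [Set.indicator_of_mem hx, Set.indicator_of_mem (hiff.1 hx)]
          rfl
        · rw [Set.indicator_of_notMem hx, Set.indicator_of_notMem fun hy => hx (hiff.2 hy)]
      refine Eq.trans (lintegral_congr fun ω => ?_) (key.trans ?_)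
      · split_ifs with hω
        · rfl
        · exact hsw ω _ (ENNReal.coe_toNNReal hω).le
      · congr 1
        refine lintegral_congr fun ω => lintegral_congr fun t => ?_
        split_ifs with ht
        · exact (hsw ω t ht.2).symm
        · rfl
  have hC' : Measurable C := hC.mono hle le_rfl
  rw [← hMint C hC', ← hNint C hC', ← lintegral_trim hle hC, ← lintegral_trim hle hC, hMN]

end RenewalIntensity

/-! ### Stopping the transmission at the first count -/

section Predictable

variable {Ω : Type*} {m : MeasurableSpace Ω}

theorem measurableSet_predictable_lt {F : Filtration ℝ≥0 m} {σ : Ω → ℝ≥0∞}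
    (hσ : ∀ t : ℝ≥0, MeasurableSet[F t] {ω | σ ω ≤ t}) :
    MeasurableSet[F.predictable] {z : ℝ≥0 × Ω | σ z.2 < z.1} := by
  have h : {z : ℝ≥0 × Ω | σ z.2 < z.1} = ⋃ q : ℚ,
      Set.Ioi (q : ℝ).toNNReal ×ˢ {ω | σ ω ≤ (q : ℝ).toNNReal} := by
    ext z
    simp only [Set.mem_ofPred_eq, Set.mem_iUnion, Set.mem_prod, Set.mem_Ioi]
    constructor
    · intro hz
      obtain ⟨q, -, h1, h2⟩ := ENNReal.lt_iff_exists_rat_btwn.1 hz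
      exact ⟨q, by exact_mod_cast h2, h1.le⟩
    · rintro ⟨q, h1, h2⟩
      exact h2.trans_lt (by exact_mod_cast h1)
  rw [h]
  exact MeasurableSet.iUnion fun q => measurableSet_predictable_Ioi_prod (hσ _)

end Predictable

/-- Consecutive gaps are disjoint, so at most one of them contains `t`. -/
theorem tsum_gap_le {e : ℕ → ℝ≥0∞} (he : Monotone e) (t b : ℝ≥0∞) :
    ∑' n, (if e n < t ∧ t ≤ e (n + 1) then b else 0) ≤ b := by
  by_cases h : ∃ n, e n < t ∧ t ≤ e (n + 1)
  · obtain ⟨n, hn⟩ := h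
    rw [tsum_eq_single n, if_pos hn]
    intro k hk
    rw [if_neg]
    rintro ⟨h1, h2⟩
    rcases lt_or_gt_of_ne hk with h3 | h3
    · exact absurd (h2.trans (he h3)) (not_le.2 hn.1)
    · exact absurd (hn.2.trans (he h3)) (not_le.2 h1)
  · simp [not_exists.1 h]

section StopAtFirstCount

variable {Ω : Type*} {m : MeasurableSpace Ω} {G : ℕ → Ω → ℝ≥0∞} {κ : ℕ → ℝ≥0} {Q : Measure Ω}
  [IsProbabilityMeasure Q]

/-- The points do not accumulate: by the intensity identity, the mean number of points before `t` is
at most `t` times a bound for the rates. -/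
theorem IsExponentialGaps.ae_exists_lt_epoch (h : IsExponentialGaps G κ Q) {b : ℝ≥0}
    (hκ : ∀ n, κ n ≤ b) : ∀ᵐ ω ∂Q, ∀ t : ℝ≥0, ∃ n, (t : ℝ≥0∞) < epoch G n ω := by
  have key : ∀ N : ℕ, ∀ᵐ ω ∂Q, ∃ n, (((N : ℝ≥0) : ℝ≥0) : ℝ≥0∞) < epoch G n ω := by
    intro N
    have hE := fun k => measurable_epoch h.measurable k
    have hset : ∀ n, MeasurableSet {ω | epoch G (n + 1) ω ≤ ((N : ℝ≥0) : ℝ≥0∞)} := fun n =>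
      measurableSet_le (hE _) measurable_const
    let B : Set (ℝ≥0 × Ω) := Set.Ioi (N : ℝ≥0) ×ˢ Set.univ
    have hB : MeasurableSet[(gapHistory G h.measurable).predictable] B :=
      measurableSet_predictable_Ioi_prod MeasurableSet.univ
    have hgap := fun n => h.lintegral_gap n (C := Bᶜ.indicator 1)
      ((@measurable_const _ _ _ (gapHistory G h.measurable).predictable 1).indicator hB.compl)
    have hmeas : ∀ n, Measurable fun ω =>
        (if epoch G (n + 1) ω ≤ ((N : ℝ≥0) : ℝ≥0∞) then (1 : ℝ≥0∞) else 0) := fun n =>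
      Measurable.ite (hset n) measurable_const measurable_const
    have hfin : ∫⁻ ω, ∑' n, (if epoch G (n + 1) ω ≤ ((N : ℝ≥0) : ℝ≥0∞) then (1 : ℝ≥0∞) else 0) ∂Q
        ≤ b * N := by
      rw [lintegral_tsum fun n => (hmeas n).aemeasurable]
      have hC : ∀ (t : ℝ≥0) (ω : Ω), Bᶜ.indicator (1 : ℝ≥0 × Ω → ℝ≥0∞) (t, ω)
          = (Set.Iic (N : ℝ≥0)).indicator 1 t := by
        intro t ω
        by_cases ht : t ≤ N
        · simp [B, ht]
        · simp [B, ht, not_le.1 ht]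
      have hle : ∀ n, ∫⁻ ω, (if epoch G (n + 1) ω ≤ ((N : ℝ≥0) : ℝ≥0∞) then (1 : ℝ≥0∞) else 0) ∂Q
          ≤ b * ∫⁻ ω, ∫⁻ t, (if epoch G n ω < t ∧ (t : ℝ≥0∞) ≤ epoch G (n + 1) ω
            then (Set.Iic (N : ℝ≥0)).indicator 1 t else 0) ∂timeMeasure ∂Q := by
        intro n
        refine le_trans (le_of_eq ?_) ((hgap n).le.trans ?_)
        · refine lintegral_congr fun ω => ?_
          by_cases hω : epoch G (n + 1) ω = ∞
          · simp [hω]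
          · rw [if_neg hω, hC]
            simp only [Set.indicator_apply, Set.mem_Iic, Pi.one_apply]
            conv_lhs => rw [← ENNReal.coe_toNNReal hω]
            norm_cast
        · simp_rw [hC]
          exact mul_le_mul_left (ENNReal.coe_le_coe.2 (hκ n)) _
      have hm2 : ∀ n, Measurable fun z : Ω × ℝ≥0 =>
          (if epoch G n z.1 < z.2 ∧ (z.2 : ℝ≥0∞) ≤ epoch G (n + 1) z.1
            then (Set.Iic (N : ℝ≥0)).indicator (1 : ℝ≥0 → ℝ≥0∞) z.2 else 0) := by
        intro n
        have h2 : Measurable fun y : Ω × ℝ≥0 => (y.2 : ℝ≥0∞) :=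
          measurable_coe_nnreal_ennreal.comp measurable_snd
        refine Measurable.ite ((measurableSet_lt ((hE n).comp measurable_fst) h2).inter
          (measurableSet_le h2 ((hE (n + 1)).comp measurable_fst))) ?_ measurable_const
        exact (measurable_one.indicator measurableSet_Iic).comp measurable_snd
      refine (ENNReal.tsum_le_tsum hle).trans ?_
      rw [ENNReal.tsum_mul_left,
        ← lintegral_tsum fun n => (hm2 n).lintegral_prod_right'.aemeasurable]
      refine mul_le_mul_right ?_ _
      calc _ ≤ ∫⁻ _ : Ω, (N : ℝ≥0∞) ∂Q := lintegral_mono fun ω => ?_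
        _ = N := by simp
      have hm3 : ∀ n, Measurable fun t : ℝ≥0 =>
          (if epoch G n ω < t ∧ (t : ℝ≥0∞) ≤ epoch G (n + 1) ω
            then (Set.Iic (N : ℝ≥0)).indicator (1 : ℝ≥0 → ℝ≥0∞) t else 0) := fun n =>
        (hm2 n).comp (measurable_prodMk_left (x := ω))
      simp only
      rw [← lintegral_tsum fun n => (hm3 n).aemeasurable]
      refine (lintegral_mono fun t => tsum_gap_le (monotone_epoch G ω) _ _).trans ?_
      rw [lintegral_indicator_one measurableSet_Iic, timeMeasure_Iic]
      simp
    have hlt := ae_lt_top (Measurable.tsum hmeas)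
      (hfin.trans_lt (ENNReal.mul_lt_top ENNReal.coe_lt_top (ENNReal.natCast_lt_top N))).ne
    filter_upwards [hlt] with ω hω
    by_contra! hcon
    have : ∀ n, (if epoch G (n + 1) ω ≤ ((N : ℝ≥0) : ℝ≥0∞) then (1 : ℝ≥0∞) else 0) = 1 :=
      fun n => if_pos (hcon (n + 1))
    simp_rw [this] at hω
    rw [ENNReal.tsum_const_eq_top_of_ne_zero one_ne_zero] at hω
    exact lt_irrefl _ hω
  filter_upwards [ae_all_iff.2 key] with ω hω t
  obtain ⟨N, hN⟩ := exists_nat_ge t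
  obtain ⟨n, hn⟩ := hω N
  exact ⟨n, lt_of_le_of_lt (by exact_mod_cast hN) hn⟩

/-- The input that transmits at power `a` until the first count of the output, and then stops. -/
noncomputable def stopInput (G : ℕ → Ω → ℝ≥0∞) (a : ℝ≥0) (t : ℝ≥0) (ω : Ω) : ℝ≥0 :=
  if (t : ℝ≥0∞) ≤ epoch G 1 ω then a else 0

theorem progressive_stopInput (hG : ∀ n, Measurable (G n)) (a : ℝ≥0) :
    IsStronglyProgressive (gapHistory G hG) (stopInput G a) := by
  refine IsStronglyPredictable.isStronglyProgressive ?_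
  have h := measurableSet_predictable_lt (F := gapHistory G hG) (σ := epoch G 1)
    fun t => measurableSet_epoch_le_gapHistory hG le_rfl 0
  have h' : MeasurableSet[(gapHistory G hG).predictable]
      {z : ℝ≥0 × Ω | (z.1 : ℝ≥0∞) ≤ epoch G 1 z.2} := by
    convert! h.compl using 1
    ext z
    simp
  exact (Measurable.ite h' (@measurable_const _ _ _ (gapHistory G hG).predictable a)
    (@measurable_const _ _ _ (gapHistory G hG).predictable 0)).stronglyMeasurable

/-- If the first gap has rate `a + dark` and the others have rate `dark`, the output has the
intensity of the input that stops at the first count. -/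
theorem IsExponentialGaps.admitsIntensity {a dark : ℝ≥0}
    (h : IsExponentialGaps G (fun n => if n = 0 then a + dark else dark) Q) :
    AdmitsIntensity (gapHistory G h.measurable) Q (fun n => epoch G (n + 1))
      (fun t ω => stopInput G a t ω + dark) := by
  have hE := fun k => measurable_epoch h.measurable k
  have hae := h.ae_exists_lt_epoch (b := a + dark) fun n => by split_ifs <;> simp
  refine ⟨isPointSequence_epoch h.pos, ?_, fun t => measurable_count_gapHistory h.measurable le_rfl,
    ?_, ?_, ?_⟩
  · filter_upwards [hae] with ω hω t
    obtain ⟨n, hn⟩ := hω t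
    have hmono : Monotone fun n => epoch G (n + 1) ω :=
      fun a b hab => monotone_epoch G ω (by omega)
    have h1 : ¬ ((n : ℕ∞) < count (fun n => epoch G (n + 1) ω) t) := by
      rw [lt_count_iff hmono, not_le]
      exact hn.trans_le (monotone_epoch G ω (Nat.le_succ n))
    exact (not_lt.1 h1).trans_lt (ENat.natCast_lt_top n)
  · intro i
    exact (progressive_stopInput h.measurable a i).add stronglyMeasurable_const
  · refine Filter.Eventually.of_forall fun ω t => ?_
    refine (setLIntegral_mono' measurableSet_Icc (g := fun _ => ((a + dark : ℝ≥0) : ℝ≥0∞))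
      fun s _ => ENNReal.coe_le_coe.2 ?_).trans_lt ?_
    · unfold stopInput
      split_ifs <;> simp
    · rw [setLIntegral_const]
      refine ENNReal.mul_lt_top ENNReal.coe_lt_top ?_
      refine (measure_mono (Set.Icc_subset_Iic_self : Set.Icc 0 t ⊆ Set.Iic t)).trans_lt ?_
      rw [timeMeasure_Iic]
      exact ENNReal.coe_lt_top
  · intro C hC
    let D : ℝ≥0 × Ω → ℝ≥0∞ := fun z => (C z.1 z.2 : ℝ≥0∞)
    have hD : Measurable[(gapHistory G h.measurable).predictable] D :=
      measurable_coe_nnreal_ennreal.comp hC.measurable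
    have hD' : Measurable D := hD.mono (predictable_le_prod _) le_rfl
    have hm1 : ∀ n, Measurable fun ω => if epoch G (n + 1) ω = ∞ then 0
        else D ((epoch G (n + 1) ω).toNNReal, ω) := fun n =>
      Measurable.ite (measurableSet_eq_fun (hE _) measurable_const) measurable_const
        (hD'.comp ((ENNReal.measurable_toNNReal.comp (hE _)).prodMk measurable_id))
    have hm2 : ∀ n, Measurable fun z : Ω × ℝ≥0 =>
        (if epoch G n z.1 < z.2 ∧ (z.2 : ℝ≥0∞) ≤ epoch G (n + 1) z.1
          then D (z.2, z.1) else 0) := by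
      intro n
      have h2 : Measurable fun y : Ω × ℝ≥0 => (y.2 : ℝ≥0∞) :=
        measurable_coe_nnreal_ennreal.comp measurable_snd
      exact Measurable.ite ((measurableSet_lt ((hE n).comp measurable_fst) h2).inter
        (measurableSet_le h2 ((hE (n + 1)).comp measurable_fst)))
        (hD'.comp measurable_swap) measurable_const
    have e1 : ∫⁻ ω, countIntegral (fun n => epoch G (n + 1) ω) (fun t => C t ω) ∂Q
        = ∑' n, ∫⁻ ω, (if epoch G (n + 1) ω = ∞ then 0
          else D ((epoch G (n + 1) ω).toNNReal, ω)) ∂Q :=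
      lintegral_tsum fun n => (hm1 n).aemeasurable
    rw [e1]
    simp_rw [h.lintegral_gap _ hD]
    simp_rw [← lintegral_const_mul' _ _ (ENNReal.coe_ne_top)]
    rw [← lintegral_tsum fun n => ((hm2 n).const_mul _).lintegral_prod_right'.aemeasurable]
    refine lintegral_congr_ae ?_
    filter_upwards [hae] with ω hω
    have hm3 : ∀ n, Measurable fun t : ℝ≥0 => ((if n = 0 then a + dark else dark : ℝ≥0) : ℝ≥0∞) *
        (if epoch G n ω < t ∧ (t : ℝ≥0∞) ≤ epoch G (n + 1) ω then D (t, ω) else 0) := fun n =>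
      ((hm2 n).comp (measurable_prodMk_left (x := ω))).const_mul _
    rw [← lintegral_tsum fun n => (hm3 n).aemeasurable]
    have h0 : ∀ᵐ t ∂timeMeasure, t ≠ 0 := by
      simp [ae_iff]
    refine lintegral_congr_ae ?_
    filter_upwards [h0] with t ht
    -- the gap that contains the instant `t`
    have hex : ∃ n, (t : ℝ≥0∞) ≤ epoch G (n + 1) ω := by
      obtain ⟨n, hn⟩ := hω t
      exact ⟨n, hn.le.trans (monotone_epoch G ω (Nat.le_succ n))⟩
    classical
    let n := Nat.find hex
    have hn2 : (t : ℝ≥0∞) ≤ epoch G (n + 1) ω := Nat.find_spec hex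
    have hn1 : epoch G n ω < t := by
      rcases Nat.eq_zero_or_pos n with h1 | h1
      · rw [h1]
        simpa [epoch] using pos_iff_ne_zero.2 ht
      · have := Nat.find_min hex (m := n - 1) (by omega)
        rw [Nat.sub_add_cancel h1] at this
        exact not_le.1 this
    rw [tsum_eq_single n]
    · simp only [hn1, hn2, and_self, if_true, D]
      rw [mul_comm]
      congr 1
      norm_cast
      rcases Nat.eq_zero_or_pos n with h1 | h1
      · rw [h1] at hn2
        simp only [zero_add] at hn2
        simp [h1, stopInput, hn2]
      · have h2 : ¬ (t : ℝ≥0∞) ≤ epoch G 1 ω :=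
          not_le.2 ((monotone_epoch G ω h1).trans_lt hn1)
        simp [h1.ne', stopInput, h2]
    · intro k hk
      refine mul_eq_zero_of_right _ (if_neg ?_)
      rintro ⟨h1, h2⟩
      rcases lt_or_gt_of_ne hk with h3 | h3
      · exact absurd (h2.trans (monotone_epoch G ω h3)) (not_le.2 hn1)
      · exact absurd (hn2.trans (monotone_epoch G ω h3)) (not_le.2 h1)

end StopAtFirstCount

/-! ### The scheme that stops at the first count -/

section StopScheme

/-- The sample space: the bit, and the successive gaps of the output. -/
abbrev BitGaps : Type u := ULift.{u} (Bool × (ℕ → ℝ≥0∞))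

/-- The `n`-th gap of the output. The value `0`, which has probability zero, is replaced by `1` to
make all gaps positive. -/
noncomputable def bitGap (n : ℕ) (ω : BitGaps.{u}) : ℝ≥0∞ :=
  if ω.down.2 n = 0 then 1 else ω.down.2 n

/-- The conditional law given `D = d`: the first gap has rate `a d + dark`, the others `dark`. -/
noncomputable def condLaw (dark : ℝ≥0) (a : Bool → ℝ≥0) (d : Bool) : Measure BitGaps.{u} :=
  (Measure.infinitePi fun n : ℕ => gapLaw (if n = 0 then a d + dark else dark)).map
    fun x => ULift.up (d, x)

/-- The law under which the bit is equiprobable. -/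
noncomputable def bitLaw (dark : ℝ≥0) (a : Bool → ℝ≥0) : Measure BitGaps.{u} :=
  (2⁻¹ : ℝ≥0∞) • (condLaw dark a false + condLaw dark a true)

theorem measurable_up_prodMk (d : Bool) :
    Measurable fun x : ℕ → ℝ≥0∞ => (ULift.up (d, x) : BitGaps.{u}) :=
  measurable_up.comp measurable_prodMk_left

theorem measurable_bitGap (n : ℕ) : Measurable (bitGap.{u} n) := by
  have h : Measurable fun ω : BitGaps.{u} => ω.down.2 n :=
    (measurable_pi_apply n).comp (measurable_snd.comp measurable_down)
  exact Measurable.ite (h (measurableSet_singleton 0)) measurable_const h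

instance (dark : ℝ≥0) (a : Bool → ℝ≥0) (d : Bool) :
    IsProbabilityMeasure (condLaw.{u} dark a d) :=
  Measure.isProbabilityMeasure_map (measurable_up_prodMk d).aemeasurable

theorem isExponentialGaps_bitGap (dark : ℝ≥0) (a : Bool → ℝ≥0) (d : Bool) :
    IsExponentialGaps bitGap.{u} (fun n => if n = 0 then a d + dark else dark)
      (condLaw dark a d) := by
  let r : ℝ≥0∞ → ℝ≥0∞ := fun x => if x = 0 then 1 else x
  have hr : Measurable r :=
    Measurable.ite (measurableSet_singleton 0) measurable_const measurable_id
  have hrlaw : ∀ κ, (gapLaw κ).map r = gapLaw κ := by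
    intro κ
    have hae : r =ᵐ[gapLaw κ] id := by
      have h0 : ∀ᵐ x ∂gapLaw κ, x ≠ 0 := by
        rw [ae_iff]
        simpa using gapLaw_singleton _ ENNReal.zero_ne_top
      filter_upwards [h0] with x hx
      simp [r, hx]
    rw [Measure.map_congr hae, Measure.map_id]
  have hlaw : ∀ n, (condLaw.{u} dark a d).map (bitGap n)
      = gapLaw (if n = 0 then a d + dark else dark) := by
    intro n
    rw [condLaw, Measure.map_map (measurable_bitGap n) (measurable_up_prodMk d)]
    have e : bitGap.{u} n ∘ (fun x => ULift.up (d, x)) = r ∘ fun x : ℕ → ℝ≥0∞ => x n := rfl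
    rw [e, ← Measure.map_map hr (measurable_pi_apply n), Measure.infinitePi_map_eval, hrlaw]
  refine ⟨measurable_bitGap, fun n ω => ?_, ?_, hlaw⟩
  · unfold bitGap
    split_ifs with h
    · exact one_pos
    · exact pos_iff_ne_zero.2 h
  · rw [iIndepFun_iff_map_fun_eq_infinitePi_map measurable_bitGap]
    simp_rw [hlaw]
    rw [condLaw, Measure.map_map (measurable_pi_lambda _ measurable_bitGap)
      (measurable_up_prodMk d)]
    have e : (fun (ω : BitGaps.{u}) i => bitGap i ω) ∘ (fun x => ULift.up (d, x))
        = fun (x : ℕ → ℝ≥0∞) i => r (x i) := rfl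
    rw [e, Measure.infinitePi_map_pi _ fun _ => hr]
    simp_rw [hrlaw]

/-- The bit. -/
def bitOf (ω : BitGaps.{u}) : Bool := ω.down.1

theorem measurable_bitOf : Measurable bitOf.{u} := measurable_fst.comp measurable_down

theorem condLaw_preimage_bitOf (dark : ℝ≥0) (a : Bool → ℝ≥0) (d : Bool) (s : Set Bool) :
    condLaw.{u} dark a d (bitOf ⁻¹' s) = s.indicator 1 d := by
  rw [condLaw, Measure.map_apply (measurable_up_prodMk d)
    (measurable_bitOf (MeasurableSet.of_discrete))]
  by_cases h : d ∈ s
  · have : (fun x : ℕ → ℝ≥0∞ => (ULift.up (d, x) : BitGaps.{u})) ⁻¹' (bitOf ⁻¹' s) = Set.univ :=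
      Set.eq_univ_of_forall fun x => h
    rw [this]
    simp [h]
  · have : (fun x : ℕ → ℝ≥0∞ => (ULift.up (d, x) : BitGaps.{u})) ⁻¹' (bitOf ⁻¹' s) = ∅ :=
      Set.eq_empty_of_forall_notMem fun x => h
    rw [this]
    simp [h]

theorem bitLaw_preimage_bitOf (dark : ℝ≥0) (a : Bool → ℝ≥0) (d : Bool) :
    bitLaw.{u} dark a (bitOf ⁻¹' {d}) = 1 / 2 := by
  simp only [bitLaw, Measure.smul_apply, Measure.add_apply, condLaw_preimage_bitOf, smul_eq_mul]
  cases d <;> simp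

instance (dark : ℝ≥0) (a : Bool → ℝ≥0) : IsProbabilityMeasure (bitLaw.{u} dark a) where
  measure_univ := by
    simp only [bitLaw, Measure.smul_apply, Measure.add_apply, measure_univ, smul_eq_mul]
    rw [one_add_one_eq_two]
    exact ENNReal.inv_mul_cancel two_ne_zero ENNReal.ofNat_ne_top

theorem condLaw_restrict_bitOf (dark : ℝ≥0) (a : Bool → ℝ≥0) (d e : Bool) :
    (condLaw.{u} dark a d).restrict (bitOf ⁻¹' {e}) = if d = e then condLaw dark a d else 0 := by
  split_ifs with h
  · refine Measure.restrict_eq_self_of_ae_mem ?_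
    rw [ae_iff]
    have : {ω : BitGaps.{u} | ω ∉ bitOf ⁻¹' {e}} = bitOf ⁻¹' {e}ᶜ := rfl
    rw [this, condLaw_preimage_bitOf]
    simp [h]
  · rw [Measure.restrict_eq_zero, condLaw_preimage_bitOf]
    simp [h]

theorem cond_bitLaw (dark : ℝ≥0) (a : Bool → ℝ≥0) (d : Bool) :
    cond (bitLaw.{u} dark a) (bitOf ⁻¹' {d}) = condLaw dark a d := by
  rw [ProbabilityTheory.cond, bitLaw_preimage_bitOf, bitLaw, Measure.restrict_smul,
    Measure.restrict_add, condLaw_restrict_bitOf, condLaw_restrict_bitOf, smul_smul]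
  have h : (1 / 2 : ℝ≥0∞)⁻¹ * 2⁻¹ = 1 := by
    rw [one_div, inv_inv]
    exact ENNReal.mul_inv_cancel two_ne_zero ENNReal.ofNat_ne_top
  rw [h]
  cases d <;> simp

/-- The scheme that, if `D = d`, transmits at power `a d` until the first count. The decoder guesses
`1` if there is a count in `[0, T]`. -/
noncomputable def stopScheme (dark T : ℝ≥0) (a : Bool → ℝ≥0) :
    FeedbackScheme dark T (bitLaw.{u} dark a) where
  bit := bitOf
  measurable_bit := measurable_bitOf
  prob_bit := bitLaw_preimage_bitOf dark a
  output n := epoch bitGap (n + 1)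
  history _ := gapHistory bitGap measurable_bitGap
  input d := stopInput bitGap (a d)
  progressive_input d := progressive_stopInput measurable_bitGap (a d)
  admitsIntensity d := by
    rw [cond_bitLaw]
    exact (isExponentialGaps_bitGap dark a d).admitsIntensity
  guess ω := decide (0 < count (fun n => epoch bitGap (n + 1) ω) T)
  measurable_guess := by
    refine Measurable.comp (g := fun x : ℕ∞ => decide (0 < x)) (Measurable.of_discrete) ?_
    exact Measurable.mono (Measurable.of_comap_le le_rfl)
      (le_iSup (fun t : Set.Icc (0 : ℝ≥0) T => MeasurableSpace.comap
        (fun ω : BitGaps.{u} => count (fun n => epoch bitGap (n + 1) ω) t) inferInstance)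
        ⟨T, zero_le, le_rfl⟩) le_rfl

theorem stopScheme_peakPowerLE {dark T : ℝ≥0} {a : Bool → ℝ≥0} {A : ℝ≥0∞}
    (h : ∀ d, (a d : ℝ≥0∞) ≤ A) : (stopScheme.{u} dark T a).PeakPowerLE A := by
  refine fun d => Filter.Eventually.of_forall fun ω t => ?_
  change (stopInput bitGap (a d) t ω : ℝ≥0∞) ≤ A
  unfold stopInput
  split_ifs
  · exact h d
  · simp

theorem condLaw_bitGap_zero_mem (dark : ℝ≥0) (a : Bool → ℝ≥0) (d : Bool) {s : Set ℝ≥0∞}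
    (hs : MeasurableSet s) :
    condLaw.{u} dark a d {ω | epoch bitGap 1 ω ∈ s} = gapLaw (a d + dark) s := by
  have h := (isExponentialGaps_bitGap.{u} dark a d).law 0
  simp only [if_true] at h
  rw [← h, Measure.map_apply (measurable_bitGap 0) hs]
  congr 1
  ext ω
  simp [epoch]

/-- The mean time spent waiting before `T` for an event of rate `κ`. -/
noncomputable def meanWait (κ T : ℝ) : ℝ := ∫ t in (0 : ℝ)..T, Real.exp (-(κ * t))

theorem stopScheme_condEnergy (dark T : ℝ≥0) (a : Bool → ℝ≥0) (d : Bool) :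
    (stopScheme.{u} dark T a).condEnergy d
      = ENNReal.ofReal (a d * meanWait (a d + dark) T) := by
  have h1 : (stopScheme.{u} dark T a).condEnergy d
      = ∫⁻ ω, (∫⁻ t in Set.Icc 0 T, (stopInput bitGap (a d) t ω : ℝ≥0∞) ∂timeMeasure)
        ∂(condLaw.{u} dark a d) := by
    rw [← cond_bitLaw]
    rfl
  have hm : Measurable (epoch bitGap.{u} 1) := measurable_epoch measurable_bitGap 1
  have hset : MeasurableSet {z : BitGaps.{u} × ℝ≥0 | (z.2 : ℝ≥0∞) ≤ epoch bitGap 1 z.1} :=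
    measurableSet_le (measurable_coe_nnreal_ennreal.comp measurable_snd) (hm.comp measurable_fst)
  rw [h1, lintegral_lintegral_swap]
  · have h2 : ∀ t : ℝ≥0, ∫⁻ ω, (stopInput bitGap (a d) t ω : ℝ≥0∞) ∂(condLaw.{u} dark a d)
        = ENNReal.ofReal (a d * Real.exp (-((a d + dark) * t))) := by
      intro t
      have h3 : (fun ω : BitGaps.{u} => (stopInput bitGap (a d) t ω : ℝ≥0∞))
          = {ω | epoch bitGap 1 ω ∈ Set.Ici (t : ℝ≥0∞)}.indicator fun _ => (a d : ℝ≥0∞) := by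
        ext ω
        by_cases h : (t : ℝ≥0∞) ≤ epoch bitGap 1 ω <;> simp [stopInput, h]
      have h4 := gapLaw_Ici (a d + dark) t.coe_nonneg
      rw [ENNReal.ofReal_coe_nnreal] at h4
      refine (congrArg (lintegral _) h3).trans ((lintegral_indicator_const
        (show MeasurableSet {ω | epoch bitGap 1 ω ∈ Set.Ici (t : ℝ≥0∞)} from
          hm measurableSet_Ici) _).trans ?_)
      rw [condLaw_bitGap_zero_mem _ _ _ measurableSet_Ici, h4,
        ENNReal.ofReal_mul NNReal.zero_le_coe]
      simp
    simp_rw [h2]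
    rw [← lintegral_indicator measurableSet_Icc, lintegral_timeMeasure,
      ← lintegral_indicator measurableSet_Ici, meanWait, ← intervalIntegral.integral_const_mul,
      intervalIntegral.integral_of_le NNReal.zero_le_coe, ofReal_integral_eq_lintegral_ofReal]
    · rw [Measure.restrict_congr_set Ioc_ae_eq_Icc, ← lintegral_indicator measurableSet_Icc]
      refine lintegral_congr fun x => ?_
      by_cases hx : 0 ≤ x
      · by_cases hx' : x ≤ T
        · have : x.toNNReal ≤ T := Real.toNNReal_le_iff_le_coe.2 hx'
          simp [Set.indicator_apply, hx, hx', this]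
        · have : ¬ x.toNNReal ≤ T := fun h => hx' (Real.toNNReal_le_iff_le_coe.1 h)
          simp [Set.indicator_apply, hx', this]
      · simp [Set.indicator_apply, hx]
    · exact (Continuous.integrableOn_Ioc (by fun_prop))
    · exact Filter.Eventually.of_forall fun x =>
        mul_nonneg NNReal.zero_le_coe (Real.exp_nonneg _)
  · refine Measurable.aemeasurable ?_
    exact measurable_coe_nnreal_ennreal.comp (Measurable.ite hset measurable_const measurable_const)

theorem stopScheme_errorProb_le (dark T : ℝ≥0) (a : Bool → ℝ≥0) :
    (stopScheme.{u} dark T a).errorProb ≤ 2⁻¹ *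
      (ENNReal.ofReal (1 - Real.exp (-((a false + dark) * T)))
        + ENNReal.ofReal (Real.exp (-((a true + dark) * T)))) := by
  have hpt : ∀ ω : BitGaps.{u}, (0 < count (fun n => epoch bitGap (n + 1) ω) T)
      ↔ epoch bitGap 1 ω ≤ T := fun ω => by
    have := lt_count_iff (τ := fun n => epoch bitGap (n + 1) ω)
      (fun a b hab => monotone_epoch bitGap ω (by omega)) 0 T
    simpa using this
  have h1 : (stopScheme.{u} dark T a).errorProb
      = 2⁻¹ * (condLaw dark a false {ω | decide (epoch bitGap.{u} 1 ω ≤ T) ≠ bitOf ω}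
        + condLaw dark a true {ω | decide (epoch bitGap.{u} 1 ω ≤ T) ≠ bitOf ω}) := by
    simp_rw [← hpt]
    rfl
  have hbit : ∀ d, ∀ᵐ ω ∂condLaw.{u} dark a d, bitOf ω = d := by
    intro d
    rw [ae_iff]
    have : {ω : BitGaps.{u} | ¬ bitOf ω = d} = bitOf ⁻¹' {d}ᶜ := rfl
    rw [this, condLaw_preimage_bitOf]
    simp
  rw [h1]
  refine mul_le_mul_right (add_le_add ?_ ?_) _
  · have h2 := gapLaw_Iic (a false + dark) T
    push_cast at h2
    rw [← h2, ← condLaw_bitGap_zero_mem.{u} dark a false measurableSet_Iic]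
    refine measure_mono_ae ?_
    filter_upwards [hbit false] with ω hω hne
    have hne' : decide (epoch bitGap 1 ω ≤ T) ≠ bitOf ω := hne
    rw [hω] at hne'
    exact show epoch bitGap 1 ω ≤ T by simpa using hne'
  · have h2 := gapLaw_Ici (a true + dark) T.coe_nonneg
    rw [ENNReal.ofReal_coe_nnreal] at h2
    push_cast at h2
    rw [← h2, ← condLaw_bitGap_zero_mem.{u} dark a true measurableSet_Ici]
    refine measure_mono_ae ?_
    filter_upwards [hbit true] with ω hω hne
    have hne' : decide (epoch bitGap 1 ω ≤ T) ≠ bitOf ω := hne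
    rw [hω] at hne'
    exact (not_le.1 (by simpa using hne')).le

end StopScheme

/-! ### Reliable transmission with energy one half -/

theorem mul_meanWait (κ T : ℝ) : κ * meanWait κ T = 1 - Real.exp (-(κ * T)) := by
  rw [meanWait, ← intervalIntegral.integral_const_mul]
  have h : ∀ t ∈ Set.uIcc 0 T,
      HasDerivAt (fun t => -Real.exp (-(κ * t))) (κ * Real.exp (-(κ * t))) t :=
    fun t _ => hasDerivAt_neg_exp_mul_exp
  rw [intervalIntegral.integral_eq_sub_of_hasDerivAt h
    (Continuous.intervalIntegrable (by fun_prop) _ _)]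
  simp
  ring

theorem meanWait_nonneg (κ : ℝ) {T : ℝ} (hT : 0 ≤ T) : 0 ≤ meanWait κ T :=
  intervalIntegral.integral_nonneg hT fun _ _ => Real.exp_nonneg _

theorem meanWait_le {κ T : ℝ} (hκ : 0 ≤ κ) (hT : 0 ≤ T) : meanWait κ T ≤ T := by
  have h := intervalIntegral.integral_mono_on (f := fun t => Real.exp (-(κ * t)))
    (g := fun _ => (1 : ℝ)) hT (μ := volume)
    (Continuous.intervalIntegrable (by fun_prop) _ _) intervalIntegrable_const
    fun t ht => Real.exp_le_one_iff.2 (neg_nonpos.2 (mul_nonneg hκ ht.1))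
  simpa [meanWait] using h

theorem continuous_meanWait (T : ℝ) : Continuous fun κ => meanWait κ T :=
  intervalIntegral.continuous_parametric_intervalIntegral_of_continuous' (by fun_prop) _ _

/-- Without a peak-power constraint a short burst, and without dark current a long transmission,
makes both the probability of no count and the mean number of dark counts small. -/
theorem exists_power_duration {dark : ℝ≥0} {A : ℝ≥0∞} (hA : 0 < A) (h : A = ∞ ∨ dark = 0) {ε : ℝ}
    (hε : 0 < ε) : ∃ a T : ℝ≥0, (a : ℝ≥0∞) ≤ A ∧ Real.exp (-(a * T)) + dark * T < ε := by
  obtain ⟨M, hM⟩ : ∃ M : ℝ≥0, Real.exp (-M) < ε / 2 := by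
    refine ⟨(1 - Real.log (ε / 2)).toNNReal, ?_⟩
    rw [← Real.lt_log_iff_exp_lt (by positivity)]
    have := Real.le_coe_toNNReal (1 - Real.log (ε / 2))
    linarith
  by_cases hd : dark = 0
  · obtain ⟨a, ha0, haA⟩ := ENNReal.lt_iff_exists_nnreal_btwn.1 hA
    have ha : a ≠ 0 := by
      rintro rfl
      simp at ha0
    refine ⟨a, M / a, haA.le, ?_⟩
    have : a * (M / a) = M := mul_div_cancel₀ M ha
    rw [← NNReal.coe_mul, this, hd]
    simp
    linarith
  · have hA' : A = ∞ := h.resolve_right hd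
    have hd' : (0 : ℝ) < dark := by exact_mod_cast pos_iff_ne_zero.2 hd
    let T : ℝ≥0 := ⟨ε / (2 * dark), by positivity⟩
    have hT : (T : ℝ) = ε / (2 * dark) := rfl
    have hT0 : T ≠ 0 := by
      have : (0 : ℝ) < T := by rw [hT]; positivity
      exact_mod_cast this.ne'
    refine ⟨M / T, T, by simp [hA'], ?_⟩
    have h1 : M / T * T = M := div_mul_cancel₀ M hT0
    have h2 : (dark : ℝ) * T = ε / 2 := by rw [hT]; field_simp
    rw [← NNReal.coe_mul, h1, h2]
    linarith

theorem reliablyTransmissible_half {dark : ℝ≥0} {A : ℝ≥0∞} (hA : 0 < A) (h : A = ∞ ∨ dark = 0) :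
    ReliablyTransmissible.{u} dark A (1 / 2) := by
  intro ε hε
  obtain ⟨r, hr0, hr⟩ := ENNReal.lt_iff_exists_nnreal_btwn.1
    (lt_min hε (by norm_num : (0 : ℝ≥0∞) < ((1 / 2 : ℝ≥0) : ℝ≥0∞)))
  have hrε : (r : ℝ≥0∞) < ε := hr.trans_le (min_le_left _ _)
  have hr2 : (r : ℝ) < 1 / 2 := by
    have : r < 1 / 2 := by exact_mod_cast hr.trans_le (min_le_right _ _)
    exact_mod_cast this
  have hr0' : (0 : ℝ) < r := by exact_mod_cast hr0
  obtain ⟨a₁, T, ha₁, haT⟩ := exists_power_duration hA h hr0'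
  have hTn : (0 : ℝ) ≤ T := T.coe_nonneg
  have hdn : (0 : ℝ) ≤ dark := dark.coe_nonneg
  have han : (0 : ℝ) ≤ a₁ := a₁.coe_nonneg
  have hdT : 0 ≤ (dark : ℝ) * T := mul_nonneg hdn hTn
  let f : ℝ → ℝ := fun x => x * meanWait (x + dark) T
  have hf : Continuous f :=
    continuous_id.mul ((continuous_meanWait T).comp (continuous_id.add continuous_const))
  have hfx : ∀ x, f x = 1 - Real.exp (-((x + dark) * T)) - dark * meanWait (x + dark) T := by
    intro x
    have := mul_meanWait (x + dark) T
    simp only [f]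
    linarith
  have hw : ∀ x : ℝ, 0 ≤ x → dark * meanWait (x + dark) T ≤ dark * T := fun x hx =>
    mul_le_mul_of_nonneg_left (meanWait_le (add_nonneg hx hdn) hTn) hdn
  have hw0 : ∀ x : ℝ, 0 ≤ dark * meanWait (x + dark) T := fun x =>
    mul_nonneg hdn (meanWait_nonneg _ hTn)
  have hexp : Real.exp (-((a₁ + dark) * T)) ≤ Real.exp (-(a₁ * T)) :=
    Real.exp_le_exp.2 (by nlinarith)
  have hf1 : f a₁ ≤ 1 := by
    rw [hfx]
    linarith [Real.exp_nonneg (-((a₁ + dark) * T : ℝ)), hw0 a₁]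
  have hf2 : 1 - f a₁ < r := by
    rw [hfx]
    linarith [hw a₁ han]
  -- the energy left over by `D = 1` is spent when `D = 0`
  obtain ⟨x, hx, hfx0⟩ : ∃ x ∈ Set.Icc (0 : ℝ) a₁, f x = 1 - f a₁ := by
    have h0 : f 0 = 0 := by simp [f]
    exact intermediate_value_Icc han hf.continuousOn
      ⟨by rw [h0]; linarith, by linarith⟩
  let a : Bool → ℝ≥0 := fun d => if d then a₁ else ⟨x, hx.1⟩
  have hat : (a true : ℝ) = a₁ := rfl
  have haf : (a false : ℝ) = x := rfl
  refine ⟨T, BitGaps.{u}, inferInstance, bitLaw dark a, inferInstance, stopScheme dark T a,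
    stopScheme_peakPowerLE fun d => ?_, ?_, ?_⟩
  · refine le_trans (ENNReal.coe_le_coe.2 ?_) ha₁
    cases d
    · exact hx.2
    · exact le_rfl
  · rw [FeedbackScheme.energy, stopScheme_condEnergy, stopScheme_condEnergy, hat, haf]
    change (ENNReal.ofReal (f x) + ENNReal.ofReal (f a₁)) / 2 = _
    rw [hfx0, ← ENNReal.ofReal_add (by linarith) (by linarith)]
    simp
  · refine lt_of_le_of_lt (stopScheme_errorProb_le dark T a) (lt_of_le_of_lt ?_ hrε)
    rw [hat, haf, ← ENNReal.ofReal_add (by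
      rw [sub_nonneg, Real.exp_le_one_iff, neg_nonpos]
      exact mul_nonneg (add_nonneg hx.1 hdn) hTn) (Real.exp_nonneg _)]
    have h2 : (2⁻¹ : ℝ≥0∞) = ENNReal.ofReal 2⁻¹ := by
      rw [ENNReal.ofReal_inv_of_pos two_pos]; simp
    rw [h2, ← ENNReal.ofReal_mul (by norm_num), ← ENNReal.ofReal_coe_nnreal]
    refine ENNReal.ofReal_le_ofReal ?_
    have h3 := hfx x
    rw [hfx0] at h3
    have h4 := hfx a₁
    linarith [hw x hx.1, hw a₁ han]

/-! ### The Poisson semigroup -/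

section PoissonSemigroup

/-- The expectation of `g (n + N)` for a Poisson variable `N` of mean `x`. -/
noncomputable def poissonMean (g : ℕ → ℝ) (x : ℝ) (n : ℕ) : ℝ :=
  Real.exp (-x) * ∑' k : ℕ, g (n + k) * (x ^ k / k.factorial)

variable {g : ℕ → ℝ}

theorem summable_poisson (hg : ∀ n, |g n| ≤ 1) (x : ℝ) (n : ℕ) :
    Summable fun k : ℕ => g (n + k) * (x ^ k / k.factorial) := by
  refine Summable.of_norm_bounded (Real.summable_pow_div_factorial |x|) fun k => ?_
  rw [Real.norm_eq_abs, abs_mul, abs_div, abs_pow, Nat.abs_cast]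
  exact mul_le_of_le_one_left (by positivity) (hg _)

theorem hasDerivAt_tsum_poisson (hg : ∀ n, |g n| ≤ 1) (x : ℝ) (n : ℕ) :
    HasDerivAt (fun x : ℝ => ∑' k : ℕ, g (n + k) * (x ^ k / k.factorial))
      (∑' k : ℕ, g (n + 1 + k) * (x ^ k / k.factorial)) x := by
  let R : ℝ := |x| + 1
  let b : ℕ → ℝ := fun k => k * R ^ (k - 1) / k.factorial
  have hb : ∀ k : ℕ, b (k + 1) = R ^ k / k.factorial := by
    intro k
    simp only [b, Nat.add_sub_cancel, Nat.factorial_succ]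
    push_cast
    have : (k.factorial : ℝ) ≠ 0 := by positivity
    field_simp
  have hbs : Summable b := by
    rw [← summable_nat_add_iff 1]
    simp_rw [hb]
    exact Real.summable_pow_div_factorial R
  have hx : x ∈ Metric.ball (0 : ℝ) R := by simp [R]
  have h := hasDerivAt_tsum_of_isPreconnected (u := b)
    (g := fun (k : ℕ) (y : ℝ) => g (n + k) * (y ^ k / k.factorial))
    (g' := fun (k : ℕ) (y : ℝ) => g (n + k) * (k * y ^ (k - 1) / k.factorial))
    hbs Metric.isOpen_ball (convex_ball (0 : ℝ) R).isPreconnected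
    (fun k y _ => ((hasDerivAt_pow k y).div_const _).const_mul _)
    (fun k y hy => ?_) hx (summable_poisson hg x n) hx
  · convert! h using 1
    have hs : Summable fun k : ℕ => g (n + k) * (k * x ^ (k - 1) / k.factorial) := by
      refine Summable.of_norm_bounded hbs fun k => ?_
      rw [Real.norm_eq_abs, abs_mul, abs_div, abs_mul, abs_pow, Nat.abs_cast, Nat.abs_cast]
      refine (mul_le_of_le_one_left (by positivity) (hg _)).trans ?_
      simp only [b, R]
      gcongr
      linarith
    rw [hs.tsum_eq_zero_add]
    simp only [Nat.cast_zero, zero_mul, zero_div, mul_zero, zero_add]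
    refine tsum_congr fun k => ?_
    rw [show n + 1 + k = n + (k + 1) by ring]
    congr 1
    simp only [Nat.add_sub_cancel, Nat.factorial_succ]
    push_cast
    have : (k.factorial : ℝ) ≠ 0 := by positivity
    field_simp
  · have hy' : |y| ≤ R := by
      have : |y| < R := by simpa using hy
      exact this.le
    rw [Real.norm_eq_abs, abs_mul, abs_div, abs_mul, abs_pow, Nat.abs_cast, Nat.abs_cast]
    refine (mul_le_of_le_one_left (by positivity) (hg _)).trans ?_
    simp only [b]
    gcongr

theorem hasDerivAt_poissonMean (hg : ∀ n, |g n| ≤ 1) (x : ℝ) (n : ℕ) :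
    HasDerivAt (fun x => poissonMean g x n) (poissonMean g x (n + 1) - poissonMean g x n) x := by
  have h := ((hasDerivAt_neg x).exp).mul (hasDerivAt_tsum_poisson hg x n)
  convert! h using 1
  simp only [poissonMean]
  ring

@[simp]
theorem poissonMean_zero (g : ℕ → ℝ) (n : ℕ) : poissonMean g 0 n = g n := by
  rw [poissonMean, tsum_eq_single 0]
  · simp
  · intro k hk
    simp [hk]

theorem poissonMean_one (x : ℝ) (n : ℕ) : poissonMean (fun _ => 1) x n = 1 := by
  have h : ∑' k : ℕ, x ^ k / (k.factorial : ℝ) = Real.exp x := by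
    rw [Real.exp_eq_exp_ℝ, NormedSpace.exp_eq_tsum_div]
  simp only [poissonMean, one_mul, h]
  rw [← Real.exp_add]
  simp

theorem poissonMean_one_sub (hg : ∀ n, |g n| ≤ 1) (x : ℝ) (n : ℕ) :
    poissonMean (fun n => 1 - g n) x n = 1 - poissonMean g x n := by
  conv_rhs => rw [← poissonMean_one x n]
  simp only [poissonMean]
  rw [← mul_sub, ← (summable_poisson (g := fun _ => 1) (by simp) x n).tsum_sub
    (summable_poisson hg x n)]
  simp_rw [sub_mul]

theorem poissonMean_nonneg (hg : ∀ n, 0 ≤ g n) {x : ℝ} (hx : 0 ≤ x) (n : ℕ) :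
    0 ≤ poissonMean g x n :=
  mul_nonneg (Real.exp_nonneg _) (tsum_nonneg fun k => mul_nonneg (hg _) (by positivity))

theorem poissonMean_le_one (hg : ∀ n, 0 ≤ g n) (hg1 : ∀ n, g n ≤ 1) {x : ℝ} (hx : 0 ≤ x) (n : ℕ) :
    poissonMean g x n ≤ 1 := by
  have h := poissonMean_nonneg (g := fun n => 1 - g n) (fun n => sub_nonneg.2 (hg1 n)) hx n
  rw [poissonMean_one_sub fun n => abs_le.2 ⟨by linarith [hg n], hg1 n⟩] at h
  linarith

end PoissonSemigroup

/-! ### The fundamental theorem of calculus along a counting path -/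

section CountingPath

/-- The number `Y(t-)` of points in `[0, t)`. -/
noncomputable def countBefore (τ : ℕ → ℝ≥0∞) (t : ℝ≥0) : ℕ∞ :=
  {n : ℕ | τ n < t}.encard

theorem mem_iff_lt_toNat_encard {S : Set ℕ} (hS : IsLowerSet S) {M : ℕ} (hM : M ∉ S) (n : ℕ) :
    n ∈ S ↔ n < S.encard.toNat := by
  have h1 : S.encard ≤ M := not_lt.1 fun h => hM ((lt_encard_iff_mem hS M).1 h)
  have h2 : (S.encard.toNat : ℕ∞) = S.encard :=
    ENat.natCast_toNat (ne_top_of_le_ne_top (ENat.natCast_ne_top M) h1)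
  rw [← lt_encard_iff_mem hS, ← h2]
  exact_mod_cast Iff.rfl

theorem toNat_encard_le {S : Set ℕ} (hS : IsLowerSet S) {M : ℕ} (hM : M ∉ S) :
    S.encard.toNat ≤ M :=
  not_lt.1 fun h => hM ((mem_iff_lt_toNat_encard hS hM M).2 h)

theorem isLowerSet_points_le {τ : ℕ → ℝ≥0∞} (hτ : Monotone τ) (x : ℝ≥0∞) :
    IsLowerSet {n | τ n ≤ x} := fun _ _ hab ha => (hτ hab).trans ha

theorem isLowerSet_points_lt {τ : ℕ → ℝ≥0∞} (hτ : Monotone τ) (x : ℝ≥0∞) :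
    IsLowerSet {n | τ n < x} := fun _ _ hab ha => (hτ hab).trans_lt ha

/-- A telescoping sum over the lower set `S`. -/
theorem add_sum_ite_mem {S : Set ℕ} (hS : IsLowerSet S) {M : ℕ} (hM : M ∉ S) (f : ℕ → ℝ)
    [DecidablePred (· ∈ S)] :
    f 0 + ∑ n ∈ Finset.range M, (if n ∈ S then f (n + 1) - f n else 0) = f S.encard.toNat := by
  rw [← Finset.sum_filter]
  have : (Finset.range M).filter (· ∈ S) = Finset.range S.encard.toNat := by
    ext n
    rw [Finset.mem_filter, Finset.mem_range, Finset.mem_range, mem_iff_lt_toNat_encard hS hM]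
    exact ⟨fun h => h.2, fun h => ⟨h.trans_le (toNat_encard_le hS hM), h⟩⟩
  rw [this, Finset.sum_range_sub]
  ring

/-- The fundamental theorem of calculus for a function `D` that is switched on at time `p`. -/
theorem ite_sub_ite_eq_add_integral {D D' : ℝ → ℝ} (hD : ∀ r, HasDerivAt D (D' r) r)
    (hD' : Continuous D') (p : ℝ≥0∞) {s t : ℝ≥0} (hst : s ≤ t) :
    (if p ≤ t then D t else 0) - (if p ≤ s then D s else 0)
      = (if s < p ∧ p ≤ t then D p.toReal else 0)
        + ∫ r in (s : ℝ)..t, (if p < ENNReal.ofReal r then D' r else 0) := by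
  induction p with
  | top => simp
  | coe p =>
  have hst' : (s : ℝ) ≤ t := by exact_mod_cast hst
  have key : ∫ r in (s : ℝ)..t, (if (p : ℝ≥0∞) < ENNReal.ofReal r then D' r else 0)
      = if p ≤ t then D t - D (max (s : ℝ) p) else 0 := by
    have e1 : (fun r : ℝ => if (p : ℝ≥0∞) < ENNReal.ofReal r then D' r else 0)
        = (Set.Ioi (p : ℝ)).indicator D' := by
      ext r
      have : (p : ℝ≥0∞) < ENNReal.ofReal r ↔ (p : ℝ) < r := by
        rw [ENNReal.ofReal, ENNReal.coe_lt_coe, Real.lt_toNNReal_iff_coe_lt]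
      simp [Set.indicator_apply, this]
    rw [e1, intervalIntegral.integral_of_le hst', setIntegral_indicator measurableSet_Ioi,
      Set.Ioc_inter_Ioi]
    split_ifs with hpt
    · have hmax : max (s : ℝ) p ≤ t := max_le hst' (by exact_mod_cast hpt)
      rw [← intervalIntegral.integral_of_le hmax]
      exact intervalIntegral.integral_eq_sub_of_hasDerivAt (fun r _ => hD r)
        (hD'.intervalIntegrable _ _)
    · have : (t : ℝ) < p := by exact_mod_cast not_le.1 hpt
      rw [Set.Ioc_eq_empty_of_le (this.le.trans (le_max_right _ _))]
      simp
  rw [key]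
  simp only [ENNReal.coe_le_coe, ENNReal.coe_lt_coe, ENNReal.coe_toReal]
  by_cases hpt : p ≤ t
  · by_cases hps : p ≤ s
    · simp [hpt, hps, not_lt.2 hps]
    · have h1 : max (s : ℝ) p = p := max_eq_right (by exact_mod_cast (not_le.1 hps).le)
      simp [hpt, hps, h1, not_le.1 hps]
  · have hps : ¬ p ≤ s := fun h => hpt (h.trans hst)
    simp [hpt, hps]

theorem intervalIntegrable_ite_lt_ofReal {f : ℝ → ℝ} (hf : Continuous f) (p : ℝ≥0∞) (a b : ℝ) :
    IntervalIntegrable (fun r => if p < ENNReal.ofReal r then f r else 0) volume a b := by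
  have hset : MeasurableSet {r : ℝ | p < ENNReal.ofReal r} :=
    measurableSet_lt measurable_const ENNReal.measurable_ofReal
  have h1 : IntervalIntegrable f volume a b := hf.intervalIntegrable _ _
  have e : (fun r => if p < ENNReal.ofReal r then f r else 0)
      = {r : ℝ | p < ENNReal.ofReal r}.indicator f := by
    ext r
    simp [Set.indicator_apply]
  rw [e]
  exact ⟨h1.1.indicator hset, h1.2.indicator hset⟩

theorem intervalIntegrable_finset_sum {s : Finset ℕ} {f : ℕ → ℝ → ℝ} {a b : ℝ}
    (h : ∀ n ∈ s, IntervalIntegrable (f n) volume a b) :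
    IntervalIntegrable (fun r => ∑ n ∈ s, f n r) volume a b := by
  have := IntervalIntegrable.sum s h
  convert! this using 1
  ext r
  simp

theorem countBefore_apply_eq_sum {τ : ℕ → ℝ≥0∞} (hτ : Monotone τ) {t : ℝ≥0} {M : ℕ}
    (hM : t < τ M) (v : ℕ → ℝ → ℝ) {r : ℝ} (hr : r ≤ t) :
    v (countBefore τ r.toNNReal).toNat r = v 0 r + ∑ n ∈ Finset.range M,
      (if τ n < ENNReal.ofReal r then v (n + 1) r - v n r else 0) := by
  classical
  have hr' : M ∉ {n | τ n < ENNReal.ofReal r} := by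
    intro h
    have h2 : ENNReal.ofReal r ≤ t := by
      rw [← ENNReal.ofReal_coe_nnreal]
      exact ENNReal.ofReal_le_ofReal hr
    exact absurd (hM.trans (lt_of_lt_of_le h h2)) (lt_irrefl _)
  exact (add_sum_ite_mem (isLowerSet_points_lt hτ _) hr' fun n => v n r).symm

theorem intervalIntegrable_countBefore {τ : ℕ → ℝ≥0∞} (hτ : Monotone τ) {s t : ℝ≥0} (hst : s ≤ t)
    {M : ℕ} (hM : t < τ M) {v : ℕ → ℝ → ℝ} (hv : ∀ n, Continuous (v n)) :
    IntervalIntegrable (fun r : ℝ => v (countBefore τ r.toNNReal).toNat r) volume s t := by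
  have h : IntervalIntegrable (fun r => v 0 r + ∑ n ∈ Finset.range M,
      (if τ n < ENNReal.ofReal r then v (n + 1) r - v n r else 0)) volume s t :=
    ((hv 0).intervalIntegrable _ _).add (intervalIntegrable_finset_sum fun n _ =>
      intervalIntegrable_ite_lt_ofReal ((hv _).sub (hv _)) _ _ _)
  refine (intervalIntegrable_congr fun r hr => ?_).1 h
  rw [Set.uIoc_of_le (by exact_mod_cast hst)] at hr
  exact (countBefore_apply_eq_sum hτ hM v hr.2).symm

/-- The change of `r ↦ u (Y r) r` over `(s, t]` is the sum of its jumps at the points and the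
integral of the time derivative. For a solution `u` of Kolmogorov's backward equation of the Poisson
process of rate `c`, that derivative is `-c` times the jump that a point would cause. -/
theorem sub_eq_sum_jumps_sub_integral {τ : ℕ → ℝ≥0∞} (hτ : Monotone τ) {u : ℕ → ℝ → ℝ} {c : ℝ}
    (hu : ∀ n r, HasDerivAt (u n) (-c * (u (n + 1) r - u n r)) r) {s t : ℝ≥0} (hst : s ≤ t) {M : ℕ}
    (hM : t < τ M) :
    u (count τ t).toNat t - u (count τ s).toNat s
      = (∑ n ∈ Finset.range M, if s < τ n ∧ τ n ≤ t then
          u (n + 1) (τ n).toReal - u n (τ n).toReal else 0)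
        - c * ∫ r in (s : ℝ)..t, (u ((countBefore τ r.toNNReal).toNat + 1) r
          - u (countBefore τ r.toNNReal).toNat r) := by
  classical
  have hc : ∀ n, Continuous (u n) := fun n =>
    continuous_iff_continuousAt.2 fun r => (hu n r).continuousAt
  let d : ℕ → ℝ → ℝ := fun n r => -c * (u (n + 1) r - u n r)
  have hdc : ∀ n, Continuous (d n) := fun n => ((hc _).sub (hc _)).const_mul _ |>.congr fun _ => rfl
  have hms : ∀ r : ℝ≥0, r ≤ t → M ∉ {n | τ n ≤ (r : ℝ≥0∞)} := fun r hr h =>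
    absurd (lt_of_lt_of_le hM (h.trans (ENNReal.coe_le_coe.2 hr))) (lt_irrefl _)
  have hval : ∀ r : ℝ≥0, r ≤ t → u (count τ r).toNat r
      = u 0 r + ∑ n ∈ Finset.range M, (if τ n ≤ r then u (n + 1) r - u n r else 0) := fun r hr =>
    (add_sum_ite_mem (isLowerSet_points_le hτ r) (hms r hr) fun n => u n r).symm
  have hjump : ∀ n, (if τ n ≤ t then u (n + 1) t - u n t else 0)
      - (if τ n ≤ s then u (n + 1) s - u n s else 0)
      = (if s < τ n ∧ τ n ≤ t then u (n + 1) (τ n).toReal - u n (τ n).toReal else 0)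
        + ∫ r in (s : ℝ)..t, (if τ n < ENNReal.ofReal r then d (n + 1) r - d n r else 0) := fun n =>
    ite_sub_ite_eq_add_integral (D := fun r => u (n + 1) r - u n r)
      (fun r => (hu (n + 1) r).sub (hu n r)) ((hdc _).sub (hdc _)) (τ n) hst
  have hzero : u 0 t - u 0 s = ∫ r in (s : ℝ)..t, d 0 r :=
    (intervalIntegral.integral_eq_sub_of_hasDerivAt (fun r _ => hu 0 r)
      ((hdc 0).intervalIntegrable _ _)).symm
  have hint : ∀ n, IntervalIntegrable
      (fun r => if τ n < ENNReal.ofReal r then d (n + 1) r - d n r else 0) volume s t := fun n =>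
    intervalIntegrable_ite_lt_ofReal ((hdc _).sub (hdc _)) _ _ _
  have hsum : ∫ r in (s : ℝ)..t, d (countBefore τ r.toNNReal).toNat r
      = (∫ r in (s : ℝ)..t, d 0 r) + ∑ n ∈ Finset.range M,
        ∫ r in (s : ℝ)..t, (if τ n < ENNReal.ofReal r then d (n + 1) r - d n r else 0) := by
    rw [← intervalIntegral.integral_finsetSum fun n _ => hint n,
      ← intervalIntegral.integral_add ((hdc 0).intervalIntegrable _ _)
        (intervalIntegrable_finset_sum fun n _ => hint n)]
    refine intervalIntegral.integral_congr fun r hr => ?_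
    rw [Set.uIcc_of_le (by exact_mod_cast hst)] at hr
    exact countBefore_apply_eq_sum hτ hM d hr.2
  have hfin : -(c * ∫ r in (s : ℝ)..t, (u ((countBefore τ r.toNNReal).toNat + 1) r
          - u (countBefore τ r.toNNReal).toNat r))
      = ∫ r in (s : ℝ)..t, d (countBefore τ r.toNNReal).toNat r := by
    rw [← neg_mul, ← intervalIntegral.integral_const_mul]
  rw [hval t le_rfl, hval s hst, sub_eq_add_neg (Finset.sum _ _), hfin, hsum, ← hzero,
    add_sub_add_comm, ← Finset.sum_sub_distrib, Finset.sum_congr rfl fun n _ => hjump n,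
    Finset.sum_add_distrib]
  ring

end CountingPath

/-! ### Comparison with the Poisson process over one time step -/

section OneStep

theorem countIntegral_indicator_Ioc {τ : ℕ → ℝ≥0∞} (hτ : Monotone τ) {s t : ℝ≥0} {M : ℕ}
    (hM : t < τ M) (φ : ℝ≥0 → ℝ≥0) :
    countIntegral τ ((Set.Ioc s t).indicator φ) = ENNReal.ofReal (∑ n ∈ Finset.range M,
      if s < τ n ∧ τ n ≤ t then (φ (τ n).toNNReal : ℝ) else 0) := by
  have hterm : ∀ n, (if τ n = ∞ then 0 else
      (((Set.Ioc s t).indicator φ (τ n).toNNReal : ℝ≥0) : ℝ≥0∞))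
      = ENNReal.ofReal (if s < τ n ∧ τ n ≤ t then (φ (τ n).toNNReal : ℝ) else 0) := by
    intro n
    generalize τ n = p
    induction p with
    | top => simp
    | coe p =>
      simp only [ENNReal.coe_ne_top, if_false, ENNReal.toNNReal_coe, Set.indicator_apply,
        Set.mem_Ioc, ENNReal.coe_lt_coe, ENNReal.coe_le_coe]
      split_ifs <;> simp
  rw [countIntegral, tsum_congr hterm, tsum_eq_sum (s := Finset.range M),
    ENNReal.ofReal_sum_of_nonneg]
  · intro n _
    split_ifs
    · exact NNReal.zero_le_coe
    · exact le_rfl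
  · intro n hn
    have h1 : ¬ τ n ≤ t := not_le.2 (hM.trans_le (hτ (by simpa using hn)))
    simp [h1]

theorem countBefore_point {τ : ℕ → ℝ≥0∞} (hτ : IsPointSequence τ) {n : ℕ} (hn : τ n ≠ ∞) :
    countBefore τ (τ n).toNNReal = n := by
  have h : {k : ℕ | τ k < ((τ n).toNNReal : ℝ≥0∞)} = (Finset.range n : Set ℕ) := by
    ext k
    rw [ENNReal.coe_toNNReal hn]
    simp only [Set.mem_ofPred_eq, Finset.coe_range, Set.mem_Iio]
    constructor
    · intro h
      by_contra hk
      exact absurd (hτ.mono (not_lt.1 hk)) (not_le.2 h)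
    · intro h
      have h1 : τ k < ∞ := lt_of_le_of_lt (hτ.mono h.le) (lt_top_iff_ne_top.2 hn)
      exact (hτ.lt_succ k h1).trans_le (hτ.mono h)
  rw [countBefore, h, Set.encard_coe_eq_coe_finsetCard, Finset.card_range]

theorem lintegral_Ioc_timeMeasure {s t : ℝ≥0} (hst : s ≤ t) {f : ℝ → ℝ}
    (hf : IntervalIntegrable f volume s t) (h0 : ∀ r : ℝ, 0 ≤ r → r ≤ t → 0 ≤ f r) :
    ∫⁻ r in Set.Ioc s t, ENNReal.ofReal (f r) ∂timeMeasure
      = ENNReal.ofReal (∫ r in (s : ℝ)..t, f r) := by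
  have hst' : (s : ℝ) ≤ t := by exact_mod_cast hst
  rw [← lintegral_indicator measurableSet_Ioc, lintegral_timeMeasure,
    ← lintegral_indicator measurableSet_Ici, intervalIntegral.integral_of_le hst',
    ofReal_integral_eq_lintegral_ofReal hf.1, ← lintegral_indicator measurableSet_Ioc]
  · refine lintegral_congr fun x => ?_
    by_cases hx : 0 ≤ x
    · have h1 : s < x.toNNReal ↔ (s : ℝ) < x := Real.lt_toNNReal_iff_coe_lt
      have h2 : x.toNNReal ≤ t ↔ x ≤ t := Real.toNNReal_le_iff_le_coe
      simp [Set.indicator_apply, hx, h1, h2]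
    · have h1 : ¬ (s : ℝ) < x := fun h => hx (s.coe_nonneg.trans h.le)
      simp [Set.indicator_apply, hx, h1]
  · refine (ae_restrict_iff' measurableSet_Ioc).2 (Filter.Eventually.of_forall fun r hr => ?_)
    exact h0 r (s.coe_nonneg.trans hr.1.le) hr.2

/-- `1 + u (Y(r-) + 1) r - u (Y(r-)) r`: one plus the change of `u (Y r) r` caused by a point at
time `r`. The summand one makes it nonnegative if `u` has values in `[0, 1]`. -/
noncomputable def onePlusJump (u : ℕ → ℝ → ℝ) (k : ℕ∞) (r : ℝ≥0) : ℝ≥0 :=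
  (1 + (u (k.toNat + 1) r - u k.toNat r)).toNNReal

/-- The fundamental theorem of calculus along a counting path, with all terms nonnegative. -/
theorem ofReal_add_countIntegral_eq {τ : ℕ → ℝ≥0∞} (hτ : IsPointSequence τ) {u : ℕ → ℝ → ℝ}
    {c : ℝ≥0} (hu : ∀ n r, HasDerivAt (u n) (-c * (u (n + 1) r - u n r)) r) {s t : ℝ≥0}
    (hst : s ≤ t) (h0 : ∀ n (r : ℝ), r ≤ t → 0 ≤ u n r)
    (h1 : ∀ n (r : ℝ), r ≤ t → u n r ≤ 1)
    (hfin : count τ t < ⊤) :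
    ENNReal.ofReal (u (count τ t).toNat t) + countIntegral τ ((Set.Ioc s t).indicator 1)
        + c * ∫⁻ r in Set.Ioc s t, (onePlusJump u (countBefore τ r) r : ℝ≥0∞) ∂timeMeasure
      = ENNReal.ofReal (u (count τ s).toNat s)
        + countIntegral τ ((Set.Ioc s t).indicator fun r => onePlusJump u (countBefore τ r) r)
        + c * ENNReal.ofReal (t - s) := by
  obtain ⟨M, hM⟩ : ∃ M, (t : ℝ≥0∞) < τ M := by
    refine ⟨(count τ t).toNat, ?_⟩
    by_contra h
    rw [not_lt, ← lt_count_iff hτ.mono, ENat.natCast_toNat hfin.ne] at h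
    exact lt_irrefl _ h
  have hst' : (s : ℝ) ≤ t := by exact_mod_cast hst
  have hc : ∀ n, Continuous (u n) := fun n =>
    continuous_iff_continuousAt.2 fun r => (hu n r).continuousAt
  have hjump : ∀ n (r : ℝ), r ≤ t → 0 ≤ 1 + (u (n + 1) r - u n r) := fun n r hr => by
    linarith [h0 (n + 1) r hr, h1 n r hr]
  have hI := intervalIntegrable_countBefore hτ.mono hst hM
    (v := fun n r => u (n + 1) r - u n r) fun n => (hc _).sub (hc _)
  have hI' : IntervalIntegrable (fun r : ℝ => 1 + (u ((countBefore τ r.toNNReal).toNat + 1) r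
      - u (countBefore τ r.toNNReal).toNat r)) volume s t := intervalIntegrable_const.add hI
  have e1 : ∫⁻ r in Set.Ioc s t, (onePlusJump u (countBefore τ r) r : ℝ≥0∞) ∂timeMeasure
      = ENNReal.ofReal ((t - s) + ∫ r in (s : ℝ)..t,
        (u ((countBefore τ r.toNNReal).toNat + 1) r - u (countBefore τ r.toNNReal).toNat r)) := by
    have h := lintegral_Ioc_timeMeasure hst hI' fun r _ hr => hjump _ r hr
    rw [intervalIntegral.integral_add intervalIntegrable_const hI] at h
    simp only [intervalIntegral.integral_const, smul_eq_mul, mul_one] at h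
    rw [← h]
    refine lintegral_congr fun r => ?_
    rw [Real.toNNReal_coe]
    rfl
  have e2 : ∑ n ∈ Finset.range M, (if s < τ n ∧ τ n ≤ t then
      ((fun r => onePlusJump u (countBefore τ r) r) (τ n).toNNReal : ℝ) else 0)
      = (∑ n ∈ Finset.range M, if s < τ n ∧ τ n ≤ t then (1 : ℝ) else 0)
        + ∑ n ∈ Finset.range M, if s < τ n ∧ τ n ≤ t then
          u (n + 1) (τ n).toReal - u n (τ n).toReal else 0 := by
    rw [← Finset.sum_add_distrib]
    refine Finset.sum_congr rfl fun n _ => ?_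
    split_ifs with h
    · have hn : τ n ≠ ∞ := ne_top_of_le_ne_top ENNReal.coe_ne_top h.2
      have hle : (τ n).toReal ≤ t := by
        simpa using ENNReal.toReal_mono ENNReal.coe_ne_top h.2
      simp only [onePlusJump, countBefore_point hτ hn, ENat.toNat_natCast]
      rw [Real.coe_toNNReal]
      · rfl
      · exact hjump n _ hle
    · simp
  have hK : 0 ≤ ∑ n ∈ Finset.range M, if s < τ n ∧ τ n ≤ t then (1 : ℝ) else 0 :=
    Finset.sum_nonneg fun n _ => by split_ifs <;> norm_num
  have hKJ : 0 ≤ (∑ n ∈ Finset.range M, if s < τ n ∧ τ n ≤ t then (1 : ℝ) else 0)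
        + ∑ n ∈ Finset.range M, if s < τ n ∧ τ n ≤ t then
          u (n + 1) (τ n).toReal - u n (τ n).toReal else 0 := by
    rw [← e2]
    exact Finset.sum_nonneg fun n _ => by
      split_ifs
      · exact NNReal.zero_le_coe
      · exact le_rfl
  have hD : 0 ≤ ((t - s : ℝ) + ∫ r in (s : ℝ)..t,
      (u ((countBefore τ r.toNNReal).toNat + 1) r - u (countBefore τ r.toNNReal).toNat r)) := by
    have h := intervalIntegral.integral_nonneg (μ := volume) hst' fun r hr =>
      hjump (countBefore τ r.toNNReal).toNat r hr.2
    rw [intervalIntegral.integral_add intervalIntegrable_const hI] at h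
    simpa using h
  have main := sub_eq_sum_jumps_sub_integral hτ.mono hu hst hM
  have e3 := countIntegral_indicator_Ioc hτ.mono (s := s) hM 1
  simp only [Pi.one_apply, NNReal.coe_one] at e3
  rw [e1, e3, countIntegral_indicator_Ioc hτ.mono hM, e2, ← ENNReal.ofReal_coe_nnreal (p := c),
    ← ENNReal.ofReal_mul c.coe_nonneg, ← ENNReal.ofReal_mul c.coe_nonneg,
    ← ENNReal.ofReal_add (h0 _ _ le_rfl) hK, ← ENNReal.ofReal_add (h0 _ _ hst') hKJ,
    ← ENNReal.ofReal_add (add_nonneg (h0 _ _ le_rfl) hK) (mul_nonneg c.coe_nonneg hD),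
    ← ENNReal.ofReal_add (add_nonneg (h0 _ _ hst') hKJ)
      (mul_nonneg c.coe_nonneg (sub_nonneg.2 hst'))]
  congr 1
  linear_combination main


end OneStep

section OneStepExpectation

theorem measurable_onePlusJump {u : ℕ → ℝ → ℝ} (hu : ∀ n, Continuous (u n)) :
    Measurable fun z : ℕ∞ × ℝ≥0 => onePlusJump u z.1 z.2 :=
  measurable_from_prod_countable_right fun k => Continuous.measurable <|
    continuous_real_toNNReal.comp (continuous_const.add
      (((hu (k.toNat + 1)).comp NNReal.continuous_coe).sub
        ((hu k.toNat).comp NNReal.continuous_coe)))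

theorem measurable_fst_predictable {Ω : Type*} {m : MeasurableSpace Ω} (F : Filtration ℝ≥0 m) :
    Measurable[F.predictable] (Prod.fst : ℝ≥0 × Ω → ℝ≥0) := by
  refine @measurable_of_Ioi _ _ _ _ _ F.predictable _ _ _ _ fun i => ?_
  have : (Prod.fst : ℝ≥0 × Ω → ℝ≥0) ⁻¹' Set.Ioi i = Set.Ioi i ×ˢ Set.univ := by
    ext z
    simp
  rw [this]
  exact measurableSet_predictable_Ioi_prod MeasurableSet.univ

variable {Ω : Type*} {m : MeasurableSpace Ω} {F : Filtration ℝ≥0 m} {Q : Measure Ω}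
  {τ : ℕ → Ω → ℝ≥0∞} {X : ℝ≥0 → Ω → ℝ≥0} {c : ℝ≥0}

theorem AdmitsIntensity.measurableSet_point_le {ℓ : ℝ≥0 → Ω → ℝ≥0} (h : AdmitsIntensity F Q τ ℓ)
    (n : ℕ) (t : ℝ≥0) : MeasurableSet[F t] {ω | τ n ω ≤ t} := by
  have h1 := h.adapted t (MeasurableSet.of_discrete (s := Set.Ioi (n : ℕ∞)))
  convert! h1 using 1
  ext ω
  exact (lt_count_iff (h.isPointSequence ω).mono n t).symm

theorem AdmitsIntensity.measurable_countBefore {ℓ : ℝ≥0 → Ω → ℝ≥0} (h : AdmitsIntensity F Q τ ℓ) :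
    Measurable[F.predictable] fun z : ℝ≥0 × Ω => countBefore (fun n => τ n z.2) z.1 :=
  @measurable_encard_of_isLowerSet _ F.predictable (fun z => {n | τ n z.2 < z.1})
    (fun z => isLowerSet_points_lt (h.isPointSequence z.2).mono _)
    fun n => measurableSet_predictable_lt fun t => h.measurableSet_point_le n t

theorem AdmitsIntensity.measurable_onePlusJump_countBefore {ℓ : ℝ≥0 → Ω → ℝ≥0}
    (h : AdmitsIntensity F Q τ ℓ) {u : ℕ → ℝ → ℝ} (hu : ∀ n, Continuous (u n)) :
    Measurable[F.predictable] fun z : ℝ≥0 × Ω =>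
      onePlusJump u (countBefore (fun n => τ n z.2) z.1) z.1 := by
  have h1 : Measurable[F.predictable] fun z : ℝ≥0 × Ω =>
      ((countBefore (fun n => τ n z.2) z.1, z.1) : ℕ∞ × ℝ≥0) :=
    @Measurable.prodMk _ F.predictable _ _ _ _ _ _ h.measurable_countBefore
      (measurable_fst_predictable F)
  exact (measurable_onePlusJump hu).comp h1

theorem countIntegral_prod_indicator (σ : ℕ → ℝ≥0∞) (s t : ℝ≥0) (A : Set Ω)
    (φ : ℝ≥0 × Ω → ℝ≥0) (ω : Ω) :
    countIntegral σ (fun r => (Set.Ioc s t ×ˢ A).indicator φ (r, ω))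
      = A.indicator (fun ω => countIntegral σ ((Set.Ioc s t).indicator fun r => φ (r, ω))) ω := by
  by_cases hω : ω ∈ A
  · rw [Set.indicator_of_mem hω]
    congr 1
    ext1 r
    by_cases hr : r ∈ Set.Ioc s t
    · rw [Set.indicator_of_mem hr,
        Set.indicator_of_mem (show (r, ω) ∈ Set.Ioc s t ×ˢ A from ⟨hr, hω⟩)]
    · rw [Set.indicator_of_notMem hr, Set.indicator_of_notMem fun h => hr h.1]
  · rw [Set.indicator_of_notMem hω]
    have : ∀ r, (Set.Ioc s t ×ˢ A).indicator φ (r, ω) = 0 := fun r =>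
      Set.indicator_of_notMem (fun h => hω h.2) _
    simp [countIntegral, this]

/-- The intensity identity for a predictable integrand restricted to the time interval `(s, t]` and
to an event of the history at time `s`. -/
theorem AdmitsIntensity.setLIntegral_countIntegral {ℓ : ℝ≥0 → Ω → ℝ≥0}
    (h : AdmitsIntensity F Q τ ℓ) {s : ℝ≥0} (t : ℝ≥0) {A : Set Ω} (hA : MeasurableSet[F s] A)
    {φ : ℝ≥0 × Ω → ℝ≥0} (hφ : Measurable[F.predictable] φ) :
    ∫⁻ ω in A, countIntegral (fun n => τ n ω) ((Set.Ioc s t).indicator fun r => φ (r, ω)) ∂Q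
      = ∫⁻ ω in A, ∫⁻ r in Set.Ioc s t, (φ (r, ω) : ℝ≥0∞) * ℓ r ω ∂timeMeasure ∂Q := by
  have hA' : MeasurableSet A := F.le s A hA
  have hset : MeasurableSet[F.predictable] (Set.Ioc s t ×ˢ A) :=
    measurableSet_predictable_Ioc_prod s t hA
  have hC : Measurable[F.predictable] ((Set.Ioc s t ×ˢ A).indicator φ) := hφ.indicator hset
  have key := h.lintegral_eq (fun r ω => (Set.Ioc s t ×ˢ A).indicator φ (r, ω))
    hC.stronglyMeasurable
  rw [← lintegral_indicator hA', ← lintegral_indicator hA']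
  refine Eq.trans (lintegral_congr fun ω => ?_) (key.trans (lintegral_congr fun ω => ?_))
  · exact (countIntegral_prod_indicator _ s t A φ ω).symm
  · by_cases hω : ω ∈ A
    · rw [Set.indicator_of_mem hω, ← lintegral_indicator measurableSet_Ioc]
      refine lintegral_congr fun r => ?_
      by_cases hr : r ∈ Set.Ioc s t
      · rw [Set.indicator_of_mem hr,
          Set.indicator_of_mem (show (r, ω) ∈ Set.Ioc s t ×ˢ A from ⟨hr, hω⟩)]
      · rw [Set.indicator_of_notMem hr, Set.indicator_of_notMem fun h => hr h.1]
        simp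
    · rw [Set.indicator_of_notMem hω]
      have : ∀ r, (Set.Ioc s t ×ˢ A).indicator φ (r, ω) = 0 := fun r =>
        Set.indicator_of_notMem (fun h => hω h.2) _
      simp [this]

/-- On an event of the history at time `s`, the expectation of `g (Y t)` falls short of its value
for a Poisson process started at time `s` by at most the energy spent in `(s, t]`. With
`u n r` the Poisson expectation of `g` at time `t` from the state `n` at time `r`, the difference is
the expectation of the integral of `(u (Y(r-) + 1) r - u (Y(r-)) r) * X r`, by the intensity
identity, and that factor of `X r` is at least `-1`. -/
theorem AdmitsIntensity.setLIntegral_poissonMean_le [IsProbabilityMeasure Q]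
    (h : AdmitsIntensity F Q τ fun t ω => X t ω + c) {s t : ℝ≥0} (hst : s ≤ t) {A : Set Ω}
    (hA : MeasurableSet[F s] A) {g : ℕ → ℝ} (hg0 : ∀ n, 0 ≤ g n) (hg1 : ∀ n, g n ≤ 1) :
    ∫⁻ ω in A, ENNReal.ofReal (poissonMean g (c * (t - s)) (count (fun n => τ n ω) s).toNat) ∂Q
      ≤ (∫⁻ ω in A, ENNReal.ofReal (g (count (fun n => τ n ω) t).toNat) ∂Q)
        + ∫⁻ ω in A, ∫⁻ r in Set.Ioc s t, (X r ω : ℝ≥0∞) ∂timeMeasure ∂Q := by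
  have hg : ∀ n, |g n| ≤ 1 := fun n => abs_le.2 ⟨by linarith [hg0 n], hg1 n⟩
  let u : ℕ → ℝ → ℝ := fun n r => poissonMean g (c * (t - r)) n
  have hu : ∀ n r, HasDerivAt (u n) (-c * (u (n + 1) r - u n r)) r := by
    intro n r
    have h1 : HasDerivAt (fun r : ℝ => (c : ℝ) * (t - r)) (c * (-1)) r :=
      ((hasDerivAt_id r).const_sub (t : ℝ)).const_mul _
    have h2 := (hasDerivAt_poissonMean hg (c * (t - r)) n).comp r h1
    convert! h2 using 1
    simp only [u]
    ring
  have hx : ∀ r : ℝ, r ≤ t → 0 ≤ (c : ℝ) * (t - r) := fun r hr =>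
    mul_nonneg c.coe_nonneg (sub_nonneg.2 hr)
  have h0 : ∀ n (r : ℝ), r ≤ t → 0 ≤ u n r := fun n r hr => poissonMean_nonneg hg0 (hx r hr) n
  have h1 : ∀ n (r : ℝ), r ≤ t → u n r ≤ 1 := fun n r hr =>
    poissonMean_le_one hg0 hg1 (hx r hr) n
  have hc : ∀ n, Continuous (u n) := fun n =>
    continuous_iff_continuousAt.2 fun r => (hu n r).continuousAt
  have hut : ∀ n, u n t = g n := fun n => by simp [u]
  have hA' : MeasurableSet A := F.le s A hA
  let φ : ℝ≥0 × Ω → ℝ≥0 := fun z => onePlusJump u (countBefore (fun n => τ n z.2) z.1) z.1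
  have hφ : Measurable[F.predictable] φ := h.measurable_onePlusJump_countBefore hc
  have hφ' : Measurable φ := hφ.mono (predictable_le_prod F) le_rfl
  have hφr : ∀ ω, Measurable fun r => (φ (r, ω) : ℝ≥0∞) := fun ω =>
    measurable_coe_nnreal_ennreal.comp (hφ'.comp measurable_prodMk_right)
  -- the terms of the path identity
  let d : Ω → ℝ≥0∞ := fun ω => ∫⁻ r in Set.Ioc s t, (φ (r, ω) : ℝ≥0∞) ∂timeMeasure
  have hd : Measurable d :=
    Measurable.lintegral_prod_right' (f := fun z : Ω × ℝ≥0 => (φ (z.2, z.1) : ℝ≥0∞))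
      (measurable_coe_nnreal_ennreal.comp (hφ'.comp measurable_swap))
  have hcount : ∀ r : ℝ≥0, Measurable fun ω => (count (fun n => τ n ω) r).toNat := fun r =>
    (Measurable.of_discrete (f := ENat.toNat)).comp ((h.adapted r).mono (F.le r) le_rfl)
  have ha : Measurable fun ω => ENNReal.ofReal (u (count (fun n => τ n ω) t).toNat t) :=
    (Measurable.of_discrete (f := fun n : ℕ => ENNReal.ofReal (u n t))).comp (hcount t)
  have ha' : Measurable fun ω => ENNReal.ofReal (u (count (fun n => τ n ω) s).toNat s) :=
    (Measurable.of_discrete (f := fun n : ℕ => ENNReal.ofReal (u n s))).comp (hcount s)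
  let K : Ω → ℝ≥0∞ := fun ω => countIntegral (fun n => τ n ω) ((Set.Ioc s t).indicator 1)
  let J : Ω → ℝ≥0∞ := fun ω =>
    countIntegral (fun n => τ n ω) ((Set.Ioc s t).indicator fun r => φ (r, ω))
  have hE : ∫⁻ ω in A, (ENNReal.ofReal (u (count (fun n => τ n ω) t).toNat t) + K ω + c * d ω) ∂Q
      = ∫⁻ ω in A, (ENNReal.ofReal (u (count (fun n => τ n ω) s).toNat s) + J ω
        + c * ENNReal.ofReal (t - s)) ∂Q :=
    lintegral_congr_ae <| ae_restrict_of_ae <| h.count_lt_top.mono fun ω hω =>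
      ofReal_add_countIntegral_eq (h.isPointSequence ω) hu hst h0 h1 (hω t)
  rw [lintegral_add_right _ (hd.const_mul _), lintegral_add_left ha, lintegral_const_mul _ hd,
    lintegral_add_right _ measurable_const, lintegral_add_left ha'] at hE
  -- the expectations of the two sums over points
  have hb : ∫⁻ ω in A, K ω ∂Q = _ :=
    h.setLIntegral_countIntegral t hA (φ := 1) (@measurable_const _ _ _ F.predictable 1)
  have hb' : ∫⁻ ω in A, J ω ∂Q = _ := h.setLIntegral_countIntegral t hA hφ
  have hvol : timeMeasure (Set.Ioc s t) = ENNReal.ofReal (t - s) := timeMeasure_Ioc s t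
  have eb : ∫⁻ ω in A, ∫⁻ r in Set.Ioc s t,
      ((1 : ℝ≥0 × Ω → ℝ≥0) (r, ω) : ℝ≥0∞) * ((X r ω + c : ℝ≥0) : ℝ≥0∞) ∂timeMeasure ∂Q
      = (∫⁻ ω in A, ∫⁻ r in Set.Ioc s t, (X r ω : ℝ≥0∞) ∂timeMeasure ∂Q)
        + ∫⁻ _ in A, c * ENNReal.ofReal (t - s) ∂Q := by
    rw [← lintegral_add_right _ measurable_const]
    refine lintegral_congr fun ω => ?_
    simp only [Pi.one_apply, ENNReal.coe_one, one_mul, ENNReal.coe_add]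
    rw [lintegral_add_right _ measurable_const, setLIntegral_const, hvol]
  have eb' : ∫⁻ ω in A, ∫⁻ r in Set.Ioc s t,
      (φ (r, ω) : ℝ≥0∞) * ((X r ω + c : ℝ≥0) : ℝ≥0∞) ∂timeMeasure ∂Q
      = (∫⁻ ω in A, ∫⁻ r in Set.Ioc s t, (φ (r, ω) : ℝ≥0∞) * X r ω ∂timeMeasure ∂Q)
        + c * ∫⁻ ω in A, d ω ∂Q := by
    rw [← lintegral_const_mul _ hd, ← lintegral_add_right _ (hd.const_mul _)]
    refine lintegral_congr fun ω => ?_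
    rw [← lintegral_const_mul _ (hφr ω), ← lintegral_add_right _ ((hφr ω).const_mul _)]
    refine lintegral_congr fun r => ?_
    rw [ENNReal.coe_add, mul_add, mul_comm (c : ℝ≥0∞)]
  rw [eb] at hb
  rw [eb'] at hb'
  -- the dark-current terms on both sides agree and are finite, so they cancel
  have hdfin : ∫⁻ ω in A, d ω ∂Q ≠ ∞ := by
    have hle : ∀ ω, d ω ≤ 2 * ENNReal.ofReal (t - s) := by
      intro ω
      rw [← hvol, ← setLIntegral_const]
      refine setLIntegral_mono' measurableSet_Ioc fun r hr => ?_
      have hr' : (r : ℝ) ≤ t := by exact_mod_cast hr.2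
      have : φ (r, ω) ≤ 2 := by
        refine Real.toNNReal_le_iff_le_coe.2 ?_
        have := h1 ((countBefore (fun n => τ n ω) r).toNat + 1) r hr'
        have := h0 (countBefore (fun n => τ n ω) r).toNat r hr'
        push_cast
        linarith
      exact_mod_cast this
    refine ne_top_of_le_ne_top ?_ (lintegral_mono hle)
    rw [lintegral_const]
    exact ENNReal.mul_ne_top (ENNReal.mul_ne_top ENNReal.ofNat_ne_top ENNReal.ofReal_ne_top)
      (measure_ne_top _ _)
  have hKfin : (∫⁻ _ in A, c * ENNReal.ofReal (t - s) ∂Q) + c * ∫⁻ ω in A, d ω ∂Q ≠ ∞ := by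
    rw [lintegral_const]
    exact ENNReal.add_ne_top.2 ⟨ENNReal.mul_ne_top
      (ENNReal.mul_ne_top ENNReal.coe_ne_top ENNReal.ofReal_ne_top) (measure_ne_top _ _),
      ENNReal.mul_ne_top ENNReal.coe_ne_top hdfin⟩
  rw [hb, hb'] at hE
  simp only [hut] at hE
  refine (ENNReal.add_le_add_iff_right hKfin).1 ?_
  calc _ ≤ _ := add_le_add_left (le_self_add
        (b := ∫⁻ ω in A, ∫⁻ r in Set.Ioc s t, (φ (r, ω) : ℝ≥0∞) * X r ω ∂timeMeasure ∂Q)) _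
    _ = _ := by
        refine Eq.trans ?_ (hE.symm.trans ?_)
        · ring
        · ring

end OneStepExpectation

/-! ### Comparison with the Poisson process at finitely many times -/

section FiniteTimes

/-- `poissonValue c θ k f` is the expectation of `f (N (θ 0), …, N (θ k))` for a Poisson process `N`
of rate `c` and times `0 = θ 0 ≤ θ 1 ≤ ⋯`, computed by integrating out the last increment first. -/
noncomputable def poissonValue (c : ℝ≥0) (θ : ℕ → ℝ≥0) : ∀ k : ℕ, ((Fin (k + 1) → ℕ) → ℝ) → ℝ
  | 0, f => f fun _ => 0
  | k + 1, f => poissonValue c θ k fun y =>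
      poissonMean (fun n => f (Fin.snoc (α := fun _ => ℕ) y n)) (c * (θ (k + 1) - θ k))
        (y (Fin.last k))

theorem poissonValue_one_sub (c : ℝ≥0) {θ : ℕ → ℝ≥0} (hθ : Monotone θ) (k : ℕ)
    {f : (Fin (k + 1) → ℕ) → ℝ} (h0 : ∀ y, 0 ≤ f y) (h1 : ∀ y, f y ≤ 1) :
    poissonValue c θ k (fun y => 1 - f y) = 1 - poissonValue c θ k f := by
  induction k with
  | zero => rfl
  | succ k ih =>
    have hx : (0 : ℝ) ≤ c * (θ (k + 1) - θ k) := mul_nonneg c.coe_nonneg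
      (sub_nonneg.2 (by exact_mod_cast hθ (Nat.le_succ k)))
    simp only [poissonValue]
    rw [← ih (fun y => poissonMean_nonneg (fun n => h0 _) hx _)
      (fun y => poissonMean_le_one (fun n => h0 _) (fun n => h1 _) hx _)]
    congr 1
    ext1 y
    exact poissonMean_one_sub (fun n => abs_le.2 ⟨by linarith [h0 (Fin.snoc y n)], h1 _⟩) _ _

variable {Ω : Type*} {m : MeasurableSpace Ω}

/-- The counts at the times `θ 0, …, θ k`. -/
noncomputable def countsAt (τ : ℕ → Ω → ℝ≥0∞) (θ : ℕ → ℝ≥0) (k : ℕ) (ω : Ω) : Fin (k + 1) → ℕ :=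
  fun i => (count (fun n => τ n ω) (θ i)).toNat

theorem countsAt_succ (τ : ℕ → Ω → ℝ≥0∞) (θ : ℕ → ℝ≥0) (k : ℕ) (ω : Ω) :
    countsAt τ θ (k + 1) ω = Fin.snoc (α := fun _ => ℕ) (countsAt τ θ k ω)
      (count (fun n => τ n ω) (θ (k + 1))).toNat := by
  ext i
  refine Fin.lastCases ?_ (fun j => ?_) i
  · rw [Fin.snoc_last]
    simp [countsAt]
  · rw [Fin.snoc_castSucc]
    simp [countsAt]

theorem lintegral_eq_tsum_preimage {α : Type*} [Countable α] {Q : Measure Ω} {h : Ω → α}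
    (hh : ∀ a, MeasurableSet (h ⁻¹' {a})) (f : Ω → ℝ≥0∞) :
    ∫⁻ ω, f ω ∂Q = ∑' a, ∫⁻ ω in h ⁻¹' {a}, f ω ∂Q := by
  rw [← lintegral_iUnion hh]
  · have : ⋃ a, h ⁻¹' {a} = Set.univ := by
      ext ω
      simp
    rw [this, Measure.restrict_univ]
  · intro a b hab
    refine Set.disjoint_left.2 fun ω ha hb => hab ?_
    exact (show h ω = a from ha).symm.trans hb

variable {F : Filtration ℝ≥0 m} {Q : Measure Ω} {τ : ℕ → Ω → ℝ≥0∞}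
  {X : ℝ≥0 → Ω → ℝ≥0} {c : ℝ≥0}

theorem AdmitsIntensity.measurableSet_countsAt {ℓ : ℝ≥0 → Ω → ℝ≥0}
    (h : AdmitsIntensity F Q τ ℓ) {θ : ℕ → ℝ≥0} (hθ : Monotone θ) (k : ℕ) (y : Fin (k + 1) → ℕ) :
    MeasurableSet[F (θ k)] (countsAt τ θ k ⁻¹' {y}) := by
  have e : countsAt τ θ k ⁻¹' {y}
      = ⋂ i : Fin (k + 1), (fun ω => count (fun n => τ n ω) (θ i)) ⁻¹' {x | x.toNat = y i} := by
    ext ω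
    simp only [Set.mem_preimage, Set.mem_singleton_iff, Set.mem_iInter, Set.mem_ofPred_eq]
    exact funext_iff
  rw [e]
  exact MeasurableSet.iInter fun i =>
    F.mono (hθ (Nat.lt_succ_iff.1 i.2)) _ (h.adapted (θ i) MeasurableSet.of_discrete)

variable [IsProbabilityMeasure Q]

theorem AdmitsIntensity.lintegral_poissonMean_le (h : AdmitsIntensity F Q τ fun t ω => X t ω + c)
    {s t : ℝ≥0} (hst : s ≤ t) {α : Type*} [Countable α] {H : Ω → α}
    (hH : ∀ a, MeasurableSet[F s] (H ⁻¹' {a})) {g : α → ℕ → ℝ} (hg0 : ∀ a n, 0 ≤ g a n)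
    (hg1 : ∀ a n, g a n ≤ 1) :
    ∫⁻ ω, ENNReal.ofReal
        (poissonMean (g (H ω)) (c * (t - s)) (count (fun n => τ n ω) s).toNat) ∂Q
      ≤ (∫⁻ ω, ENNReal.ofReal (g (H ω) (count (fun n => τ n ω) t).toNat) ∂Q)
        + ∫⁻ ω, ∫⁻ r in Set.Ioc s t, (X r ω : ℝ≥0∞) ∂timeMeasure ∂Q := by
  have hH' : ∀ a, MeasurableSet (H ⁻¹' {a}) := fun a => F.le s _ (hH a)
  rw [lintegral_eq_tsum_preimage hH', lintegral_eq_tsum_preimage hH' (fun ω =>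
    ENNReal.ofReal (g (H ω) (count (fun n => τ n ω) t).toNat)), lintegral_eq_tsum_preimage hH'
    (fun ω => ∫⁻ r in Set.Ioc s t, (X r ω : ℝ≥0∞) ∂timeMeasure), ← ENNReal.tsum_add]
  refine ENNReal.tsum_le_tsum fun a => ?_
  have key := h.setLIntegral_poissonMean_le hst (hH a) (hg0 a) (hg1 a)
  have e : ∀ f : α → Ω → ℝ≥0∞, ∫⁻ ω in H ⁻¹' {a}, f (H ω) ω ∂Q
      = ∫⁻ ω in H ⁻¹' {a}, f a ω ∂Q := fun f =>
    setLIntegral_congr_fun (hH' a) fun ω hω => by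
      have : H ω = a := hω
      simp only [this]
  rw [e fun a ω => ENNReal.ofReal
      (poissonMean (g a) (c * (t - s)) (count (fun n => τ n ω) s).toNat),
    e fun a ω => ENNReal.ofReal (g a (count (fun n => τ n ω) t).toNat)]
  exact key

/-- For a function of the counts at finitely many times, with values in `[0, 1]`, the expectation
falls short of its value for the Poisson process by at most the energy spent. -/
theorem AdmitsIntensity.poissonValue_le (h : AdmitsIntensity F Q τ fun t ω => X t ω + c)
    {θ : ℕ → ℝ≥0} (hθ : Monotone θ) (hθ0 : θ 0 = 0) (k : ℕ) {f : (Fin (k + 1) → ℕ) → ℝ}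
    (hf0 : ∀ y, 0 ≤ f y) (hf1 : ∀ y, f y ≤ 1) :
    ENNReal.ofReal (poissonValue c θ k f) ≤ (∫⁻ ω, ENNReal.ofReal (f (countsAt τ θ k ω)) ∂Q)
      + ∫⁻ ω, ∫⁻ r in Set.Ioc 0 (θ k), (X r ω : ℝ≥0∞) ∂timeMeasure ∂Q := by
  induction k with
  | zero =>
    have e : ∀ ω, countsAt τ θ 0 ω = fun _ => 0 := by
      intro ω
      ext i
      have h1 : ¬ ((0 : ℕ) : ℕ∞) < count (fun n => τ n ω) (θ 0) := by
        rw [lt_count_iff (h.isPointSequence ω).mono, hθ0]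
        simpa using (h.isPointSequence ω).pos.ne'
      have h2 : count (fun n => τ n ω) (θ 0) = 0 := by simpa using h1
      simp [countsAt, h2]
    simp [e, poissonValue]
  | succ k ih =>
    have hle : θ k ≤ θ (k + 1) := hθ (Nat.le_succ k)
    have hx : (0 : ℝ) ≤ c * (θ (k + 1) - θ k) := mul_nonneg c.coe_nonneg
      (sub_nonneg.2 (by exact_mod_cast hle))
    let g : (Fin (k + 1) → ℕ) → ℕ → ℝ := fun y n => f (Fin.snoc (α := fun _ => ℕ) y n)
    have h1 := ih (f := fun y => poissonMean (g y) (c * (θ (k + 1) - θ k)) (y (Fin.last k)))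
      (fun y => poissonMean_nonneg (fun n => hf0 _) hx _)
      (fun y => poissonMean_le_one (fun n => hf0 _) (fun n => hf1 _) hx _)
    have h2 := h.lintegral_poissonMean_le hle (h.measurableSet_countsAt hθ k) (g := g)
      (fun y n => hf0 _) (fun y n => hf1 _)
    have e : ∀ ω, g (countsAt τ θ k ω) (count (fun n => τ n ω) (θ (k + 1))).toNat
        = f (countsAt τ θ (k + 1) ω) := fun ω => by rw [countsAt_succ]
    simp only [e] at h2
    refine h1.trans ((add_le_add_left h2 _).trans ?_)
    rw [add_assoc]
    refine add_le_add_right ?_ _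
    rw [add_comm]
    refine (le_lintegral_add _ _).trans (le_of_eq (lintegral_congr fun ω => ?_))
    rw [← Set.Ioc_union_Ioc_eq_Ioc zero_le hle,
      lintegral_union measurableSet_Ioc (Set.Ioc_disjoint_Ioc_of_le le_rfl)]

/-- Two point processes on the same space with the same dark current, and an event that depends on
the counts at finitely many times: the conclusion bounds the errors in telling them apart. -/
theorem one_le_add_of_countsAt {F' : Filtration ℝ≥0 m} {Q' : Measure Ω} [IsProbabilityMeasure Q']
    {X' : ℝ≥0 → Ω → ℝ≥0} (h : AdmitsIntensity F Q τ fun t ω => X t ω + c)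
    (h' : AdmitsIntensity F' Q' τ fun t ω => X' t ω + c) {θ : ℕ → ℝ≥0} (hθ : Monotone θ)
    (hθ0 : θ 0 = 0) (k : ℕ) {T : ℝ≥0} (hT : θ k ≤ T) (S : Set (Fin (k + 1) → ℕ)) :
    1 ≤ Q (countsAt τ θ k ⁻¹' S) + Q' (countsAt τ θ k ⁻¹' S)ᶜ
      + ((∫⁻ ω, ∫⁻ r in Set.Icc 0 T, (X r ω : ℝ≥0∞) ∂timeMeasure ∂Q)
        + ∫⁻ ω, ∫⁻ r in Set.Icc 0 T, (X' r ω : ℝ≥0∞) ∂timeMeasure ∂Q') := by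
  classical
  let f : (Fin (k + 1) → ℕ) → ℝ := fun y => if y ∈ S then 1 else 0
  have hf0 : ∀ y, 0 ≤ f y := fun y => by simp only [f]; split_ifs <;> norm_num
  have hf1 : ∀ y, f y ≤ 1 := fun y => by simp only [f]; split_ifs <;> norm_num
  have h1 := h.poissonValue_le hθ hθ0 k hf0 hf1
  have h2 := h'.poissonValue_le hθ hθ0 k (f := fun y => 1 - f y)
    (fun y => sub_nonneg.2 (hf1 y)) (fun y => by linarith [hf0 y])
  rw [poissonValue_one_sub c hθ k hf0 hf1] at h2
  have hm : MeasurableSet (countsAt τ θ k ⁻¹' S) := by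
    have : countsAt τ θ k ⁻¹' S = ⋃ y ∈ S, countsAt τ θ k ⁻¹' {y} := by
      ext ω
      simp
    rw [this]
    exact MeasurableSet.biUnion (Set.to_countable S) fun y _ =>
      F.le _ _ (h.measurableSet_countsAt hθ k y)
  have e1 : ∀ ω, ENNReal.ofReal (f (countsAt τ θ k ω))
      = (countsAt τ θ k ⁻¹' S).indicator 1 ω := fun ω => by
    by_cases hω : countsAt τ θ k ω ∈ S <;> simp [f, hω]
  have e2 : ∀ ω, ENNReal.ofReal (1 - f (countsAt τ θ k ω))
      = (countsAt τ θ k ⁻¹' S)ᶜ.indicator 1 ω := fun ω => by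
    by_cases hω : countsAt τ θ k ω ∈ S <;> simp [f, hω]
  simp_rw [e1] at h1
  simp_rw [e2] at h2
  rw [lintegral_indicator_one hm] at h1
  rw [lintegral_indicator_one hm.compl] at h2
  have hsub : Set.Ioc 0 (θ k) ⊆ Set.Icc 0 T := fun r hr => ⟨hr.1.le, hr.2.trans hT⟩
  have h3 : ∀ (Y : ℝ≥0 → Ω → ℝ≥0) (ρ : Measure Ω),
      ∫⁻ ω, ∫⁻ r in Set.Ioc 0 (θ k), (Y r ω : ℝ≥0∞) ∂timeMeasure ∂ρ
        ≤ ∫⁻ ω, ∫⁻ r in Set.Icc 0 T, (Y r ω : ℝ≥0∞) ∂timeMeasure ∂ρ := fun Y ρ =>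
    lintegral_mono fun ω => lintegral_mono_set hsub
  calc (1 : ℝ≥0∞) = ENNReal.ofReal (poissonValue c θ k f + (1 - poissonValue c θ k f)) := by simp
    _ ≤ _ := ENNReal.ofReal_add_le
    _ ≤ _ := add_le_add (h1.trans (add_le_add_right (h3 X Q) _))
        (h2.trans (add_le_add_right (h3 X' Q') _))
    _ = _ := by ring

end FiniteTimes

/-! ### The converse -/

section Converse

/-- A finite set of times in `[0, T]` is contained in the range of a finite time grid. -/
theorem exists_grid (T : ℝ≥0) (J : Finset ℝ≥0) :
    (∀ t ∈ J, t ≤ T) → ∃ (k : ℕ) (θ : ℕ → ℝ≥0), Monotone θ ∧ θ 0 = 0 ∧ θ k ≤ T ∧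
      ∀ t ∈ J, ∃ i ≤ k, θ i = t := by
  refine Finset.induction_on_max J ?_ ?_
  · exact fun _ => ⟨0, fun _ => 0, monotone_const, rfl, zero_le, by simp⟩
  · intro a J hmax ih hJ
    obtain ⟨k, θ, hθ, hθ0, -, hcov⟩ := ih fun t ht => hJ t (Finset.mem_insert_of_mem ht)
    -- the points of the grid beyond `a` are not needed, as `a` is the largest of the times
    refine ⟨k + 1, fun i => if i ≤ k then min (θ i) a else a, ?_, by simp [hθ0], ?_, ?_⟩
    · intro i j hij
      by_cases hj : j ≤ k
      · have hi : i ≤ k := hij.trans hj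
        simp only [hi, hj, if_true]
        exact min_le_min_right _ (hθ hij)
      · simp only [hj, if_false]
        split_ifs
        · exact min_le_right _ _
        · exact le_rfl
    · simpa using hJ a (Finset.mem_insert_self _ _)
    · intro t ht
      rcases Finset.mem_insert.1 ht with rfl | ht'
      · exact ⟨k + 1, le_rfl, by simp⟩
      · obtain ⟨i, hi, rfl⟩ := hcov t ht'
        refine ⟨i, hi.trans (Nat.le_succ k), ?_⟩
        simp [hi, (hmax _ ht').le]

variable {Ω : Type*} {m : MeasurableSpace Ω}

/-- The σ-algebra generated by the counts during `[0, T]`. -/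
noncomputable abbrev outputAlgebra (τ : ℕ → Ω → ℝ≥0∞) (T : ℝ≥0) : MeasurableSpace Ω :=
  ⨆ t : Set.Icc (0 : ℝ≥0) T,
    MeasurableSpace.comap (fun ω => count (fun n => τ n ω) t) inferInstance

/-- The events that are determined by the counts at finitely many times in `[0, T]`. -/
noncomputable def finiteTimeEvents (τ : ℕ → Ω → ℝ≥0∞) (T : ℝ≥0) : Set (Set Ω) :=
  {B | ∃ J : Finset ℝ≥0, (∀ t ∈ J, t ≤ T) ∧ ∀ ω ω',
    (∀ t ∈ J, count (fun n => τ n ω) t = count (fun n => τ n ω') t) → (ω ∈ B ↔ ω' ∈ B)}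

theorem isSetRing_finiteTimeEvents (τ : ℕ → Ω → ℝ≥0∞) (T : ℝ≥0) :
    IsSetRing (finiteTimeEvents τ T) where
  empty_mem := ⟨∅, by simp, by simp⟩
  union_mem := by
    classical
    rintro B C ⟨J, hJ, hB⟩ ⟨K, hK, hC⟩
    refine ⟨J ∪ K, fun t ht => (Finset.mem_union.1 ht).elim (hJ t) (hK t), fun ω ω' h => ?_⟩
    have h1 := hB ω ω' fun t ht => h t (Finset.mem_union_left _ ht)
    have h2 := hC ω ω' fun t ht => h t (Finset.mem_union_right _ ht)
    exact or_congr h1 h2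
  sdiff_mem := by
    classical
    rintro B C ⟨J, hJ, hB⟩ ⟨K, hK, hC⟩
    refine ⟨J ∪ K, fun t ht => (Finset.mem_union.1 ht).elim (hJ t) (hK t), fun ω ω' h => ?_⟩
    have h1 := hB ω ω' fun t ht => h t (Finset.mem_union_left _ ht)
    have h2 := hC ω ω' fun t ht => h t (Finset.mem_union_right _ ht)
    exact and_congr h1 (not_congr h2)

theorem outputAlgebra_eq_generateFrom (τ : ℕ → Ω → ℝ≥0∞) (T : ℝ≥0) :
    outputAlgebra τ T = MeasurableSpace.generateFrom (finiteTimeEvents τ T) := by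
  refine le_antisymm (iSup_le fun t => ?_) (MeasurableSpace.generateFrom_le ?_)
  · rintro _ ⟨S, -, rfl⟩
    refine MeasurableSpace.measurableSet_generateFrom ⟨{t.1}, by simpa using t.2.2, ?_⟩
    intro ω ω' h
    have := h t.1 (Finset.mem_singleton_self _)
    simp only [Set.mem_preimage, this]
  · rintro B ⟨J, hJ, hB⟩
    let V : Ω → J → ℕ∞ := fun ω t => count (fun n => τ n ω) t
    have hV : Measurable[outputAlgebra τ T] V := by
      refine @measurable_pi_lambda _ _ _ (outputAlgebra τ T) _ _ fun t => ?_
      exact Measurable.mono (Measurable.of_comap_le le_rfl)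
        (le_iSup (fun t : Set.Icc (0 : ℝ≥0) T => MeasurableSpace.comap
          (fun ω => count (fun n => τ n ω) t) inferInstance) ⟨t.1, zero_le, hJ t t.2⟩) le_rfl
    have e : B = V ⁻¹' (V '' B) := by
      ext ω
      constructor
      · exact fun h => ⟨ω, h, rfl⟩
      · rintro ⟨ω', hω', h⟩
        exact (hB ω' ω fun t ht => congrFun h ⟨t, ht⟩).1 hω'
    rw [e]
    exact hV (Set.to_countable _).measurableSet

variable {F F' : Filtration ℝ≥0 m} {Q Q' : Measure Ω} [IsProbabilityMeasure Q]
  [IsProbabilityMeasure Q'] {τ : ℕ → Ω → ℝ≥0∞} {X X' : ℝ≥0 → Ω → ℝ≥0} {c : ℝ≥0}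

theorem one_le_add_of_finiteTimeEvents (h : AdmitsIntensity F Q τ fun t ω => X t ω + c)
    (h' : AdmitsIntensity F' Q' τ fun t ω => X' t ω + c) {T : ℝ≥0} {B : Set Ω}
    (hB : B ∈ finiteTimeEvents τ T) :
    1 ≤ Q B + Q' Bᶜ + ((∫⁻ ω, ∫⁻ r in Set.Icc 0 T, (X r ω : ℝ≥0∞) ∂timeMeasure ∂Q)
        + ∫⁻ ω, ∫⁻ r in Set.Icc 0 T, (X' r ω : ℝ≥0∞) ∂timeMeasure ∂Q') := by
  obtain ⟨J, hJ, hB⟩ := hB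
  obtain ⟨k, θ, hθ, hθ0, hθT, hcov⟩ := exists_grid T J hJ
  let S : Set (Fin (k + 1) → ℕ) :=
    {y | ∃ ω ∈ B, ∀ i : Fin (k + 1), count (fun n => τ n ω) (θ i) = y i}
  -- `B` is the event that the counts on the grid are in `S`, where all counts are finite
  have hS : ∀ ω, (∀ t, count (fun n => τ n ω) t < ⊤) → (ω ∈ B ↔ ω ∈ countsAt τ θ k ⁻¹' S) := by
    intro ω hω
    have hcast : ∀ i : Fin (k + 1),
        count (fun n => τ n ω) (θ i) = ((countsAt τ θ k ω i : ℕ) : ℕ∞) := fun i =>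
      (ENat.natCast_toNat (hω _).ne).symm
    constructor
    · exact fun hωB => ⟨ω, hωB, hcast⟩
    · rintro ⟨ω', hω', hy⟩
      refine (hB ω' ω fun t ht => ?_).1 hω'
      obtain ⟨i, hi, rfl⟩ := hcov t ht
      exact (hy ⟨i, Nat.lt_succ_of_le hi⟩).trans (hcast ⟨i, Nat.lt_succ_of_le hi⟩).symm
  have e1 : Q B = Q (countsAt τ θ k ⁻¹' S) := measure_congr <| by
    filter_upwards [h.count_lt_top] with ω hω
    exact propext (hS ω hω)
  have e2 : Q' Bᶜ = Q' (countsAt τ θ k ⁻¹' S)ᶜ := measure_congr <| by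
    filter_upwards [h'.count_lt_top] with ω hω
    exact propext (not_congr (hS ω hω))
  rw [e1, e2]
  exact one_le_add_of_countsAt h h' hθ hθ0 k hθT S

/-- The errors in telling two point processes with the same dark current apart from the output
during `[0, T]`, and the energies, sum to at least one. -/
theorem one_le_add_of_outputAlgebra (h : AdmitsIntensity F Q τ fun t ω => X t ω + c)
    (h' : AdmitsIntensity F' Q' τ fun t ω => X' t ω + c) {T : ℝ≥0} {B : Set Ω}
    (hB : MeasurableSet[outputAlgebra τ T] B) :
    1 ≤ Q B + Q' Bᶜ + ((∫⁻ ω, ∫⁻ r in Set.Icc 0 T, (X r ω : ℝ≥0∞) ∂timeMeasure ∂Q)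
        + ∫⁻ ω, ∫⁻ r in Set.Icc 0 T, (X' r ω : ℝ≥0∞) ∂timeMeasure ∂Q') := by
  have hle : outputAlgebra τ T ≤ m := iSup_le fun t =>
    ((h.adapted t.1).mono (F.le _) le_rfl).comap_le
  refine ENNReal.le_of_forall_pos_le_add fun ε hε _ => ?_
  have hε' : (0 : ℝ≥0∞) < ε / 2 := ENNReal.half_pos (by exact_mod_cast hε.ne')
  obtain ⟨C, hC, hCB⟩ := @exists_measure_symmDiff_lt_of_generateFrom_isSetRing Ω
    (outputAlgebra τ T) ((Q + Q').trim hle) (isFiniteMeasure_trim hle) _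
    (isSetRing_finiteTimeEvents τ T)
    ⟨{Set.univ}, Set.countable_singleton _, by
      rintro _ rfl
      exact ⟨∅, by simp, by simp⟩, by simp⟩
    (outputAlgebra_eq_generateFrom τ T) B hB (ε / 2) hε'
  have hCm : MeasurableSet[outputAlgebra τ T] C := by
    rw [outputAlgebra_eq_generateFrom]
    exact MeasurableSpace.measurableSet_generateFrom hC
  rw [trim_measurableSet_eq hle (hCm.symmDiff hB), Measure.add_apply] at hCB
  have h1 : Q C ≤ Q B + ε / 2 := by
    have : C ⊆ B ∪ symmDiff C B := fun ω hω => by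
      by_cases hωB : ω ∈ B
      · exact Or.inl hωB
      · exact Or.inr (Or.inl ⟨hω, hωB⟩)
    exact (measure_mono this).trans ((measure_union_le _ _).trans
      (add_le_add_right (le_self_add.trans hCB.le) _))
  have h2 : Q' Cᶜ ≤ Q' Bᶜ + ε / 2 := by
    have : Cᶜ ⊆ Bᶜ ∪ symmDiff C B := fun ω hω => by
      by_cases hωB : ω ∈ B
      · exact Or.inr (Or.inr ⟨hωB, hω⟩)
      · exact Or.inl hωB
    exact (measure_mono this).trans ((measure_union_le _ _).trans
      (add_le_add_right (le_add_self.trans hCB.le) _))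
  refine (one_le_add_of_finiteTimeEvents h h' hC).trans ?_
  refine (add_le_add_left (add_le_add h1 h2) _).trans (le_of_eq ?_)
  conv_rhs => rw [← ENNReal.add_halves (ε : ℝ≥0∞)]
  ring

theorem FeedbackScheme.errorProb_eq {dark T : ℝ≥0} {P : Measure Ω} [IsProbabilityMeasure P]
    (S : FeedbackScheme dark T P) :
    2 * S.errorProb = cond P (S.bit ⁻¹' {false}) (S.guess ⁻¹' {true})
      + cond P (S.bit ⁻¹' {true}) (S.guess ⁻¹' {true})ᶜ := by
  have hbit : ∀ d, MeasurableSet (S.bit ⁻¹' {d}) := fun d =>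
    S.measurable_bit (MeasurableSet.of_discrete)
  have hinv : (1 / 2 : ℝ≥0∞)⁻¹ = 2 := by rw [one_div, inv_inv]
  rw [cond_apply (hbit _), cond_apply (hbit _), S.prob_bit, S.prob_bit, hinv, ← mul_add]
  congr 1
  rw [FeedbackScheme.errorProb, ← measure_inter_add_sdiff _ (hbit false)]
  congr 2
  · ext ω
    simp only [Set.mem_inter_iff, Set.mem_ofPred_eq, Set.mem_preimage, Set.mem_singleton_iff]
    cases S.guess ω <;> cases S.bit ω <;> simp
  · ext ω
    simp only [Set.mem_inter_iff, Set.mem_sdiff, Set.mem_ofPred_eq, Set.mem_preimage,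
      Set.mem_singleton_iff, Set.mem_compl_iff]
    cases S.guess ω <;> cases S.bit ω <;> simp

theorem FeedbackScheme.one_half_le {dark T : ℝ≥0} {P : Measure Ω} [IsProbabilityMeasure P]
    (S : FeedbackScheme dark T P) : 1 / 2 ≤ S.errorProb + S.energy := by
  have hprob : ∀ d, IsProbabilityMeasure (cond P (S.bit ⁻¹' {d})) := fun d =>
    cond_isProbabilityMeasure (by rw [S.prob_bit]; simp)
  have hB : MeasurableSet[outputAlgebra S.output T] (S.guess ⁻¹' {true}) :=
    S.measurable_guess (MeasurableSet.of_discrete)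
  have := hprob false
  have := hprob true
  have key := one_le_add_of_outputAlgebra (S.admitsIntensity false) (S.admitsIntensity true) hB
  rw [← S.errorProb_eq] at key
  have key' : 1 ≤ 2 * S.errorProb + (S.condEnergy false + S.condEnergy true) := key
  have h2 : S.condEnergy false + S.condEnergy true = 2 * S.energy := by
    rw [FeedbackScheme.energy, ENNReal.mul_div_cancel two_ne_zero ENNReal.ofNat_ne_top]
  rw [h2, ← mul_add] at key'
  exact ENNReal.div_le_of_le_mul' key'

theorem ReliablyTransmissible.one_half_le {dark : ℝ≥0} {A E : ℝ≥0∞}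
    (h : ReliablyTransmissible.{u} dark A E) : 1 / 2 ≤ E := by
  refine ENNReal.le_of_forall_pos_le_add fun ε hε _ => ?_
  obtain ⟨T, Ω, _, P, _, S, -, hE, herr⟩ := h ε (by exact_mod_cast hε)
  rw [← hE, add_comm]
  exact S.one_half_le.trans (add_le_add_left herr.le _)

end Converse

theorem mainTheorem1 :
    (∀ darkCurrent : ℝ≥0,
      IsLeast {E : ℝ≥0∞ | ReliablyTransmissible.{u} darkCurrent ∞ E} (1 / 2)) ∧
    (∀ A : ℝ≥0∞, 0 < A → ReliablyTransmissible.{u} 0 A (1 / 2)) := by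
  refine ⟨fun darkCurrent => ⟨?_, fun E hE => ?_⟩, fun A hA => ?_⟩
  · exact reliablyTransmissible_half ENNReal.zero_lt_top (Or.inl rfl)
  · exact ReliablyTransmissible.one_half_le hE
  · exact reliablyTransmissible_half hA (Or.inr rfl)
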